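/- **Setting.** Let $\mu$ be a $\sigma$-finite Borel measure on $\mathbb R$, $A=\inf\operatorname{supp}\mu$, $B=\sup\operatorname{supp}\mu$ in $[-\infty,\infty]$, $\Theta=\{\theta\in\mathbb R:\int e^{\theta x}\,d\mu(x)<\infty\}$ and $\psi(\theta)=\log\int e^{\theta x}\,d\mu(x)$. Assume that $A<B$, that $\Theta$ is neither empty nor a single point, and that $\psi'$ maps the interior $\Theta^\circ$ onto $(A,B)$. Since $\psi''>0$ on $\Theta^\circ$, $\psi'$ has a strictly increasing inverse $\phi:(A,B)\to\Theta^\circ$; write $\Theta^\circ=(\phi(A),\phi(B))$ with $\phi(A),\phi(B)\in[-\infty,\infty]$. For $\mathbf r\in\mathbb R^m$, $\mathbf c\in\mathbb R^n$ let $\mathcal T(\mathbf r,\mathbf c)$ be the set of real $m\times n$ matrices with row sums $\mathbf r$ and column sums $\mathbf c$. An MLE for $(\mathbf r,\mathbf c)$ is a maximiser $(\boldsymbol\alpha,\boldsymbol\beta)\in\mathbb R^m\times\mathbb R^n$ of $\sum_i \mathbf r(i)\boldsymbol\alpha(i)+\sum_j\mathbf c(j)\boldsymbol\beta(j)-\sum_{i,j}\psi(\boldsymbol\alpha(i)+\boldsymbol\beta(j))$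 over all $(\boldsymbol\alpha,\boldsymbol\beta)$ with $\boldsymbol\alpha(i)+\boldsymbol\beta(j)\in\Theta^\circ$ for all $i,j$. For $\delta>0$ the margin $(\mathbf r,\mathbf c)$ is $\delta$-tame if an MLE exists and satisfies $\max(A+\delta,-1/\delta)\le\psi'(\boldsymbol\alpha(i)+\boldsymbol\beta(j))\le\min(B-\delta,1/\delta)$ for all $i,j$. Say that $(\mathbf r,\mathbf c)$ is *within* $[s,t]$ if $\mathcal T(\mathbf r,\mathbf c)\cap(A,B)^{m\times n}\neq\emptyset$ and $s\le \mathbf r(i)/n\le t$, $s\le\mathbf c(j)/m\le t$ for all $i,j$. Let $\Omega(\mu)$ be the set of $(s,t)\in(A,B)^2$ with $s\le t$ for which there is a single $\delta>0$ such that, for all $m,n\ge1$, every $m\times n$ margin within $[s,t]$ is $\delta$-tame. The typical table of $(\mathbf r,\mathbf c)$ is the minimiser over $Z\in\mathcal T(\mathbf r,\mathbf c)$ of $\sum_{i,j}D(\mu_{\phi(z_{ij})}\Vert\mu)$, provided the minimum is finite. Here $d\mu_\theta/d\mu(x)=e^{\theta x-\psi(\theta)}$ and $D(\mu_\theta\Vert\mu)=\int\log\frac{d\mu_\theta}{d\mu}\,d\mu_\theta$,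 and a summand with $z_{ij}\notin(A,B)$ is $+\infty$. **Theorem.** 1. Suppose that $\psi''$ is non-decreasing and log-convex on $\Theta^\circ$. Then $B=\infty$, and each $(s,t)\in(A,B)^2$ with $s\le t$ belongs to $\Omega(\mu)$ if $$\phi(A)<3\phi(s)-2\phi(t)\quad\text{and}\quad 2\phi(t)-\phi(s)<\phi(B).$$ 2. If $\phi(A)=-\infty$, then $(s,t)\in(A,B)^2$ with $s\le t$ does not belong to $\Omega(\mu)$ if $2\phi(t)-\phi(s)>\phi(B)$. 3. Let $0<s<t$ and let $\mu$ and $\lambda_c\in(0,\infty]$ be one of the following: - $\mu$ is the $r$-fold convolution of the counting measure on $\mathbb Z_{\ge0}$, $r\ge1$ an integer, and $\lambda_c=1+\sqrt{1+r/s}$; - $\mu$ has density $e^{-ax}x^{\gamma-1}$ on $(0,\infty)$, $a\ge0$, $\gamma>0$, and $\lambda_c=2$; - $\mu$ is a Poisson measure, $\mu(\{k\})=\kappa\rho^k/k!$ for $k\in\mathbb Z_{\ge0}$ with $\kappa,\rho>0$, or a Gaussian distribution on $\mathbb R$ with positive variance, and $\lambda_c=\infty$. If $t/s<\lambda_c$,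 then $(s,t)\in\Omega(\mu)$. If $t/s>\lambda_c$, then there are $n\times n$ margins within $[s,t]$, $n=1,2,\dots$, which have typical tables whose $(1,1)$ entry diverges to infinity as $n\to\infty$. -/

import Mathlib

open MeasureTheory ProbabilityTheory

namespace TameMargins

noncomputable section

/-- The left end point `A = inf supp μ` of the support, in `[-∞, ∞]`. -/
def suppInf (μ : Measure ℝ) : EReal := sInf ((fun x : ℝ => (x : EReal)) '' μ.support)

/-- The right end point `B = sup supp μ` of the support, in `[-∞, ∞]`. -/
def suppSup (μ : Measure ℝ) : EReal := sSup ((fun x : ℝ => (x : EReal)) '' μ.support)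

/-- The open interval `(A, B)`. -/
def meanRange (μ : Measure ℝ) : Set ℝ := {x : ℝ | suppInf μ < x ∧ (x : EReal) < suppSup μ}

/-- The set `Θ` of tilt parameters: all `θ` with `∫ e^{θ x} dμ(x) < ∞`. -/
def Theta (μ : Measure ℝ) : Set ℝ := integrableExpSet (id : ℝ → ℝ) μ

/-- The log-partition function `ψ(θ) = log ∫ e^{θ x} dμ(x)`. -/
def psi (μ : Measure ℝ) : ℝ → ℝ := cgf (id : ℝ → ℝ) μ

/-- `ψ'`, the mean of the tilted measure. -/
def psi' (μ : Measure ℝ) : ℝ → ℝ := deriv (psi μ)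

/-- `ψ''`, the variance of the tilted measure. -/
def psi'' (μ : Measure ℝ) : ℝ → ℝ := iteratedDeriv 2 (psi μ)

/-- `φ : (A, B) → Θ°`, the inverse of `ψ' : Θ° → (A, B)`. -/
def phi (μ : Measure ℝ) : ℝ → ℝ := Function.invFunOn (psi' μ) (interior (Theta μ))

/-- `φ(A)`: the left end point of `Θ° = (φ(A), φ(B))`. -/
def phiA (μ : Measure ℝ) : EReal := sInf ((fun θ : ℝ => (θ : EReal)) '' interior (Theta μ))

/-- `φ(B)`: the right end point of `Θ° = (φ(A), φ(B))`. -/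
def phiB (μ : Measure ℝ) : EReal := sSup ((fun θ : ℝ => (θ : EReal)) '' interior (Theta μ))

/-- The tilted probability measure `μ_θ`, with density `e^{θ x - ψ(θ)}` with respect to `μ`. -/
def tilt (μ : Measure ℝ) (θ : ℝ) : Measure ℝ := μ.tilted (fun x => θ * x)

/-- The transportation polytope of real `m × n` matrices with row sums `r` and column sums `c`. -/
def transport {m n : ℕ} (r : Fin m → ℝ) (c : Fin n → ℝ) : Set (Matrix (Fin m) (Fin n) ℝ) :=
  {Z | (∀ i, ∑ j, Z i j = r i) ∧ ∀ j, ∑ i, Z i j = c j}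

/-- The open domain of dual variables: `α(i) + β(j) ∈ Θ°` for all `i, j`. -/
def dualDomain (μ : Measure ℝ) (m n : ℕ) : Set ((Fin m → ℝ) × (Fin n → ℝ)) :=
  {p | ∀ i j, p.1 i + p.2 j ∈ interior (Theta μ)}

/-- The log-likelihood `⟨r, α⟩ + ⟨c, β⟩ - ∑ ψ(α(i) + β(j))`. -/
def logLik (μ : Measure ℝ) {m n : ℕ} (r : Fin m → ℝ) (c : Fin n → ℝ)
    (p : (Fin m → ℝ) × (Fin n → ℝ)) : ℝ :=
  ∑ i, r i * p.1 i + ∑ j, c j * p.2 j - ∑ i, ∑ j, psi μ (p.1 i + p.2 j)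

/-- `(α, β)` is a maximum likelihood estimate for the margin `(r, c)`. -/
def IsMLE (μ : Measure ℝ) {m n : ℕ} (r : Fin m → ℝ) (c : Fin n → ℝ)
    (p : (Fin m → ℝ) × (Fin n → ℝ)) : Prop :=
  p ∈ dualDomain μ m n ∧ IsMaxOn (logLik μ r c) (dualDomain μ m n) p

/-- The margin `(r, c)` is `δ`-tame: an MLE `(α, β)` exists (`α ⊕ β` does not depend on its
choice), and `max (A + δ, -1/δ) ≤ ψ'(α(i) + β(j)) ≤ min (B - δ, 1/δ)` for all `i, j`. -/
def IsTame (μ : Measure ℝ) (δ : ℝ) {m n : ℕ} (r : Fin m → ℝ) (c : Fin n → ℝ) : Prop :=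
  ∃ p : (Fin m → ℝ) × (Fin n → ℝ), IsMLE μ r c p ∧ ∀ i j,
    max (suppInf μ + (δ : EReal)) ((-(1 / δ) : ℝ) : EReal) ≤ (psi' μ (p.1 i + p.2 j) : EReal) ∧
    (psi' μ (p.1 i + p.2 j) : EReal) ≤ min (suppSup μ - (δ : EReal)) ((1 / δ : ℝ) : EReal)

/-- The margin `(r, c)` is realised by a matrix with all entries in `(A, B)`, and all of
`r(i)/n` and `c(j)/m` lie in `[s, t]`. -/
def MarginWithin (μ : Measure ℝ) (s t : ℝ) {m n : ℕ} (r : Fin m → ℝ) (c : Fin n → ℝ) : Prop :=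
  (∃ Z ∈ transport r c, ∀ i j, Z i j ∈ meanRange μ) ∧
    (∀ i, s ≤ r i / n ∧ r i / n ≤ t) ∧ ∀ j, s ≤ c j / m ∧ c j / m ≤ t

/-- The phase diagram `Ω(μ)`: all `(s, t) ∈ (A, B)²` with `s ≤ t` for which one `δ > 0` serves
all margins of all sizes within `[s, t]`. -/
def Omega (μ : Measure ℝ) : Set (ℝ × ℝ) :=
  {q | q.1 ∈ meanRange μ ∧ q.2 ∈ meanRange μ ∧ q.1 ≤ q.2 ∧
    ∃ δ : ℝ, 0 < δ ∧ ∀ m n : ℕ, 0 < m → 0 < n → ∀ (r : Fin m → ℝ) (c : Fin n → ℝ),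
      MarginWithin μ q.1 q.2 r c → IsTame μ δ r c}

open Classical in
/-- The relative entropy `D(μ_{φ(z)} ‖ μ) = ∫ log (dμ_{φ(z)}/dμ) dμ_{φ(z)}` for `z ∈ (A, B)`,
and `∞` otherwise. -/
def relEntropy (μ : Measure ℝ) (z : ℝ) : EReal :=
  if z ∈ meanRange μ then
    ((∫ x, llr (tilt μ (phi μ z)) μ x ∂(tilt μ (phi μ z)) : ℝ) : EReal)
  else ⊤

/-- `H(Z) = ∑ D(μ_{φ(z_ij)} ‖ μ)`. -/
def tableEntropy (μ : Measure ℝ) {m n : ℕ} (Z : Matrix (Fin m) (Fin n) ℝ) : EReal :=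
  ∑ i, ∑ j, relEntropy μ (Z i j)

/-- `Z` is the typical table for the margin `(r, c)`: the minimiser of `H`, with `H(Z) < ∞`. -/
def IsTypicalTable (μ : Measure ℝ) {m n : ℕ} (r : Fin m → ℝ) (c : Fin n → ℝ)
    (Z : Matrix (Fin m) (Fin n) ℝ) : Prop :=
  Z ∈ transport r c ∧ tableEntropy μ Z < ⊤ ∧ IsMinOn (tableEntropy μ) (transport r c) Z

/-- There are `(n+1) × (n+1)` margins within `[s, t]`, `n = 0, 1, 2, …`, such that the first entry
of their typical tables diverges to infinity. -/
def TypicalTablesBlowUp (μ : Measure ℝ) (s t : ℝ) : Prop :=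
  ∃ (r c : (n : ℕ) → Fin (n + 1) → ℝ) (Z : (n : ℕ) → Matrix (Fin (n + 1)) (Fin (n + 1)) ℝ),
    (∀ n, MarginWithin μ s t (r n) (c n) ∧ IsTypicalTable μ (r n) (c n) (Z n)) ∧
      Filter.Tendsto (fun n => Z n 0 0) Filter.atTop Filter.atTop

/-- The counting measure on `{0, 1, 2, …}`, as a measure on `ℝ`. -/
def countingNat : Measure ℝ := Measure.sum (fun k : ℕ => Measure.dirac (k : ℝ))

/-- The `r`-fold convolution of the counting measure on `{0, 1, 2, …}`; it gives mass
`(r + k - 1).choose k` to `k`. -/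
def negBinBase : ℕ → Measure ℝ
  | 0 => Measure.dirac 0
  | r + 1 => Measure.conv countingNat (negBinBase r)

/-- The measure with density `e^{-a x} x^{γ - 1}` on `(0, ∞)`. -/
def gammaBase (a γ : ℝ) : Measure ℝ :=
  (volume.restrict (Set.Ioi (0 : ℝ))).withDensity
    (fun x => ENNReal.ofReal (Real.exp (-a * x) * x ^ (γ - 1)))

/-- The Poisson measure with mass `κ * ρ ^ k / k!` at `k = 0, 1, 2, …`. Here `κ = e^{-ρ}` is the
Poisson distribution with mean `ρ`, and `κ = ρ = 1` has mass `1 / k!`. -/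
def poissonBase (κ ρ : ℝ) : Measure ℝ :=
  Measure.sum (fun k : ℕ =>
    ENNReal.ofReal (κ * ρ ^ k / (Nat.factorial k : ℝ)) • Measure.dirac (k : ℝ))

end

end TameMargins

open TameMargins

namespace TameMargins

open Filter Topology

/-- The standing assumptions on the base measure: `A < B`, `Θ` is not a point, and `ψ'` maps `Θ°`
onto `(A, B)`. -/
structure IsSteep (μ : Measure ℝ) : Prop where
  nontrivial : (Theta μ).Nontrivial
  inf_lt_sup : suppInf μ < suppSup μ
  surjOn : Set.SurjOn (psi' μ) (interior (Theta μ)) (meanRange μ)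

section LogPartition

variable {μ : Measure ℝ} {θ : ℝ}

lemma ne_zero_of_suppInf_lt_suppSup (h : suppInf μ < suppSup μ) : μ ≠ 0 := by
  rintro rfl
  simp [suppInf, suppSup] at h

lemma integrable_exp_of_mem (h : θ ∈ interior (Theta μ)) :
    Integrable (fun x => Real.exp (θ * x)) μ :=
  interior_subset (s := Theta μ) h

lemma convex_interior_Theta (μ : Measure ℝ) : Convex ℝ (interior (Theta μ)) :=
  Convex.interior (convex_integrableExpSet (X := (id : ℝ → ℝ)) (μ := μ))

lemma Icc_subset_interior_Theta {a b : ℝ} (ha : a ∈ interior (Theta μ))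
    (hb : b ∈ interior (Theta μ)) : Set.Icc a b ⊆ interior (Theta μ) :=
  (convex_interior_Theta μ).ordConnected.out ha hb

lemma nonempty_interior_Theta (h : (Theta μ).Nontrivial) : (interior (Theta μ)).Nonempty := by
  obtain ⟨x, hx, y, hy, hxy⟩ := h.exists_lt
  have hsub : Set.Ioo x y ⊆ Theta μ := Set.Ioo_subset_Icc_self.trans
    ((convex_integrableExpSet (X := (id : ℝ → ℝ)) (μ := μ)).ordConnected.out hx hy)
  exact ⟨(x + y) / 2, interior_maximal hsub isOpen_Ioo ⟨by linarith, by linarith⟩⟩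

lemma ae_suppInf_le (μ : Measure ℝ) : ∀ᵐ x : ℝ ∂μ, suppInf μ ≤ (x : EReal) := by
  filter_upwards [Measure.support_mem_ae (μ := μ)] with x hx
  exact sInf_le ⟨x, hx, rfl⟩

lemma ae_le_suppSup (μ : Measure ℝ) : ∀ᵐ x : ℝ ∂μ, (x : EReal) ≤ suppSup μ := by
  filter_upwards [Measure.support_mem_ae (μ := μ)] with x hx
  exact le_sSup ⟨x, hx, rfl⟩

lemma hasDerivAt_psi (h : θ ∈ interior (Theta μ)) : HasDerivAt (psi μ) (psi' μ θ) θ :=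
  (analyticAt_cgf h).differentiableAt.hasDerivAt

lemma hasDerivAt_psi' (h : θ ∈ interior (Theta μ)) : HasDerivAt (psi' μ) (psi'' μ θ) θ := by
  have := (analyticAt_cgf h).deriv.differentiableAt.hasDerivAt
  rwa [psi'', iteratedDeriv_succ, iteratedDeriv_one]

lemma continuousOn_psi' (μ : Measure ℝ) : ContinuousOn (psi' μ) (interior (Theta μ)) :=
  fun _ h => (hasDerivAt_psi' h).continuousAt.continuousWithinAt

lemma continuousOn_psi (μ : Measure ℝ) : ContinuousOn (psi μ) (interior (Theta μ)) :=
  fun _ h => (hasDerivAt_psi h).continuousAt.continuousWithinAt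

lemma integral_tilt (h : θ ∈ interior (Theta μ)) : ∫ x, x ∂(tilt μ θ) = psi' μ θ :=
  integral_tilted_mul_self (X := (id : ℝ → ℝ)) h

lemma memLp_tilt (h : θ ∈ interior (Theta μ)) : MemLp (id : ℝ → ℝ) 2 (tilt μ θ) :=
  memLp_tilted_mul (X := (id : ℝ → ℝ)) h 2

lemma isProbabilityMeasure_tilt (hμ : μ ≠ 0) (h : θ ∈ interior (Theta μ)) :
    IsProbabilityMeasure (tilt μ θ) :=
  have : NeZero μ := ⟨hμ⟩
  isProbabilityMeasure_tilted (integrable_exp_of_mem h)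

lemma integrable_id_tilt (hμ : μ ≠ 0) (h : θ ∈ interior (Theta μ)) :
    Integrable (fun x : ℝ => x) (tilt μ θ) :=
  have := isProbabilityMeasure_tilt hμ h
  (memLp_tilt h).integrable (by norm_num)

lemma psi'_le_suppSup (hμ : μ ≠ 0) (h : θ ∈ interior (Theta μ)) :
    (psi' μ θ : EReal) ≤ suppSup μ := by
  have := isProbabilityMeasure_tilt hμ h
  have hae : ∀ᵐ x : ℝ ∂(tilt μ θ), (x : EReal) ≤ suppSup μ :=
    (tilted_absolutelyContinuous _ _).ae_le (ae_le_suppSup μ)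
  refine EReal.le_of_forall_lt_iff_le.1 fun b hb => ?_
  have hle : ∀ᵐ x : ℝ ∂(tilt μ θ), x ≤ b := by
    filter_upwards [hae] with x hx
    exact_mod_cast (hx.trans hb.le)
  rw [← integral_tilt h]
  have := integral_mono_ae (integrable_id_tilt hμ h) (integrable_const b) hle
  simp only [integral_const, probReal_univ, one_smul] at this
  exact_mod_cast this

lemma suppInf_le_psi' (hμ : μ ≠ 0) (h : θ ∈ interior (Theta μ)) :
    suppInf μ ≤ (psi' μ θ : EReal) := by
  have := isProbabilityMeasure_tilt hμ h
  have hae : ∀ᵐ x : ℝ ∂(tilt μ θ), suppInf μ ≤ (x : EReal) :=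
    (tilted_absolutelyContinuous _ _).ae_le (ae_suppInf_le μ)
  refine EReal.ge_of_forall_gt_iff_ge.1 fun b hb => ?_
  have hle : ∀ᵐ x : ℝ ∂(tilt μ θ), b ≤ x := by
    filter_upwards [hae] with x hx
    exact_mod_cast (hb.le.trans hx)
  rw [← integral_tilt h]
  have := integral_mono_ae (integrable_const b) (integrable_id_tilt hμ h) hle
  simp only [integral_const, probReal_univ, one_smul] at this
  exact_mod_cast this

lemma psi''_pos (hlt : suppInf μ < suppSup μ) (h : θ ∈ interior (Theta μ)) : 0 < psi'' μ θ := by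
  have hμ := ne_zero_of_suppInf_lt_suppSup hlt
  have := isProbabilityMeasure_tilt hμ h
  have hvar : Var[id; tilt μ θ] = psi'' μ θ := variance_tilted_mul (X := (id : ℝ → ℝ)) h
  rw [← hvar]
  refine (variance_nonneg _ _).lt_of_ne' fun h0 => ?_
  obtain ⟨c, hc⟩ : ∃ c : ℝ, ∀ᵐ x : ℝ ∂(tilt μ θ), x = c := by
    refine ⟨(tilt μ θ)[id], ?_⟩
    have := (evariance_eq_zero_iff (memLp_tilt h).aestronglyMeasurable.aemeasurable).1
      (by rw [← (memLp_tilt h).ofReal_variance_eq, h0, ENNReal.ofReal_zero])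
    exact this
  have hcμ : ∀ᵐ x : ℝ ∂μ, x = c :=
    (absolutelyContinuous_tilted (integrable_exp_of_mem h)).ae_le hc
  have hsub : μ.support ⊆ {c} := Measure.support_subset_of_isClosed isClosed_singleton hcμ
  have hsup : suppSup μ ≤ (c : EReal) := sSup_le fun _ ⟨x, hx, hxc⟩ => by
    rw [← hxc, hsub hx]
  have hinf : (c : EReal) ≤ suppInf μ := le_sInf fun _ ⟨x, hx, hxc⟩ => by
    rw [← hxc, hsub hx]
  exact absurd (hsup.trans hinf) (not_le.2 hlt)

lemma strictMonoOn_psi' (hlt : suppInf μ < suppSup μ) :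
    StrictMonoOn (psi' μ) (interior (Theta μ)) := by
  refine strictMonoOn_of_deriv_pos (convex_interior_Theta μ) (continuousOn_psi' μ) fun x hx => ?_
  rw [interior_interior] at hx
  rw [(hasDerivAt_psi' hx).deriv]
  exact psi''_pos hlt hx

lemma mapsTo_psi' (hlt : suppInf μ < suppSup μ) :
    Set.MapsTo (psi' μ) (interior (Theta μ)) (meanRange μ) := by
  intro θ hθ
  have hμ := ne_zero_of_suppInf_lt_suppSup hlt
  have hmono := strictMonoOn_psi' hlt
  obtain ⟨ε, hε, hball⟩ := Metric.isOpen_iff.1 isOpen_interior θ hθ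
  have h1 : θ + ε / 2 ∈ interior (Theta μ) := hball (by simpa [abs_of_pos hε] using hε)
  have h2 : θ - ε / 2 ∈ interior (Theta μ) := hball (by simpa [abs_of_pos hε] using hε)
  refine ⟨(suppInf_le_psi' hμ h2).trans_lt ?_, lt_of_lt_of_le ?_ (psi'_le_suppSup hμ h1)⟩
  · exact_mod_cast hmono h2 hθ (by linarith)
  · exact_mod_cast hmono hθ h1 (by linarith)

/-- If `Θ` is bounded above then so is not the support. -/
lemma suppSup_eq_top_of_bddAbove (hne : (interior (Theta μ)).Nonempty)
    (hb : BddAbove (interior (Theta μ))) : suppSup μ = ⊤ := by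
  by_contra hB
  obtain ⟨θ, hθ⟩ := hne
  obtain ⟨M, hM⟩ : ∃ M : ℝ, suppSup μ ≤ (M : EReal) := by
    obtain ⟨M, h1, -⟩ := EReal.lt_iff_exists_real_btwn.1 (lt_top_iff_ne_top.2 hB)
    exact ⟨M, h1.le⟩
  have hall : ∀ η, θ ≤ η → η ∈ Theta μ := by
    intro η hη
    change Integrable (fun x => Real.exp (η * x)) μ
    refine ((integrable_exp_of_mem hθ).const_mul (Real.exp ((η - θ) * M))).mono'
      (by fun_prop) ?_
    filter_upwards [ae_le_suppSup μ] with x hx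
    have hx' : x ≤ M := by exact_mod_cast hx.trans hM
    rw [Real.norm_eq_abs, abs_of_pos (Real.exp_pos _), ← Real.exp_add]
    refine Real.exp_le_exp.2 ?_
    nlinarith [mul_le_mul_of_nonneg_left hx' (sub_nonneg.2 hη)]
  obtain ⟨T, hT⟩ := hb
  have hmem : max θ T + 1 ∈ interior (Theta μ) :=
    interior_maximal (fun η hη => hall η (le_of_lt hη)) isOpen_Ioi
      (show θ < max θ T + 1 by linarith [le_max_left θ T])
  linarith [hT hmem, le_max_right θ T]

/-- If `Θ` is bounded below then the support is not. -/
lemma suppInf_eq_bot_of_bddBelow (hne : (interior (Theta μ)).Nonempty)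
    (hb : BddBelow (interior (Theta μ))) : suppInf μ = ⊥ := by
  by_contra hB
  obtain ⟨θ, hθ⟩ := hne
  obtain ⟨M, hM⟩ : ∃ M : ℝ, (M : EReal) ≤ suppInf μ := by
    obtain ⟨M, -, h1⟩ := EReal.lt_iff_exists_real_btwn.1 (bot_lt_iff_ne_bot.2 hB)
    exact ⟨M, h1.le⟩
  have hall : ∀ η, η ≤ θ → η ∈ Theta μ := by
    intro η hη
    change Integrable (fun x => Real.exp (η * x)) μ
    refine ((integrable_exp_of_mem hθ).const_mul (Real.exp ((η - θ) * M))).mono'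
      (by fun_prop) ?_
    filter_upwards [ae_suppInf_le μ] with x hx
    have hx' : M ≤ x := by exact_mod_cast hM.trans hx
    rw [Real.norm_eq_abs, abs_of_pos (Real.exp_pos _), ← Real.exp_add]
    refine Real.exp_le_exp.2 ?_
    nlinarith [mul_le_mul_of_nonneg_left hx' (sub_nonneg.2 hη)]
  obtain ⟨T, hT⟩ := hb
  have hmem : min θ T - 1 ∈ interior (Theta μ) :=
    interior_maximal (fun η hη => hall η (le_of_lt hη)) isOpen_Iio
      (show min θ T - 1 < θ by linarith [min_le_left θ T])
  linarith [hT hmem, min_le_right θ T]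

lemma psi_tangent_le (hlt : suppInf μ < suppSup μ) {η : ℝ} (hθ : θ ∈ interior (Theta μ))
    (hη : η ∈ interior (Theta μ)) : psi μ θ + psi' μ θ * (η - θ) ≤ psi μ η := by
  have hconv : ConvexOn ℝ (interior (Theta μ)) (psi μ) := by
    refine MonotoneOn.convexOn_of_deriv (convex_interior_Theta μ) (continuousOn_psi μ) ?_ ?_
    · rw [interior_interior]
      exact fun x hx => (hasDerivAt_psi hx).differentiableAt.differentiableWithinAt
    · rw [interior_interior]
      exact (strictMonoOn_psi' hlt).monotoneOn
  rcases lt_trichotomy θ η with h | rfl | h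
  · have := hconv.le_slope_of_hasDerivAt hθ hη h (hasDerivAt_psi hθ)
    rw [slope_def_field, le_div_iff₀ (by linarith)] at this
    linarith
  · simp
  · have := hconv.slope_le_of_hasDerivAt hη hθ h (hasDerivAt_psi hθ)
    rw [slope_def_field, div_le_iff₀ (by linarith)] at this
    linarith

end LogPartition

namespace IsSteep

variable {μ : Measure ℝ} {θ z : ℝ}

lemma phi_mem (h : IsSteep μ) (hz : z ∈ meanRange μ) : phi μ z ∈ interior (Theta μ) :=
  Function.invFunOn_mem (h.surjOn hz)

lemma psi'_phi (h : IsSteep μ) (hz : z ∈ meanRange μ) : psi' μ (phi μ z) = z :=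
  Function.invFunOn_eq (h.surjOn hz)

lemma phi_psi' (h : IsSteep μ) (hθ : θ ∈ interior (Theta μ)) : phi μ (psi' μ θ) = θ :=
  (strictMonoOn_psi' h.inf_lt_sup).injOn (h.phi_mem (mapsTo_psi' h.inf_lt_sup hθ)) hθ
    (h.psi'_phi (mapsTo_psi' h.inf_lt_sup hθ))

lemma psi'_le_iff (h : IsSteep μ) (hθ : θ ∈ interior (Theta μ)) (hz : z ∈ meanRange μ) :
    psi' μ θ ≤ z ↔ θ ≤ phi μ z := by
  rw [← (strictMonoOn_psi' h.inf_lt_sup).le_iff_le hθ (h.phi_mem hz), h.psi'_phi hz]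

lemma le_psi'_iff (h : IsSteep μ) (hθ : θ ∈ interior (Theta μ)) (hz : z ∈ meanRange μ) :
    z ≤ psi' μ θ ↔ phi μ z ≤ θ := by
  rw [← (strictMonoOn_psi' h.inf_lt_sup).le_iff_le (h.phi_mem hz) hθ, h.psi'_phi hz]

lemma phi_mono (h : IsSteep μ) {y : ℝ} (hy : y ∈ meanRange μ) (hz : z ∈ meanRange μ)
    (hyz : y ≤ z) : phi μ y ≤ phi μ z := by
  rw [← h.le_psi'_iff (h.phi_mem hz) hy, h.psi'_phi hz]
  exact hyz

end IsSteep

section Likelihood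

variable {μ : Measure ℝ} {m n : ℕ} {r : Fin m → ℝ} {c : Fin n → ℝ}
  {Z : Matrix (Fin m) (Fin n) ℝ} {p : (Fin m → ℝ) × (Fin n → ℝ)}

lemma sum_mul_add_eq_of_mem_transport (hZ : Z ∈ transport r c) (a : Fin m → ℝ) (b : Fin n → ℝ) :
    ∑ i, ∑ j, Z i j * (a i + b j) = ∑ i, r i * a i + ∑ j, c j * b j := by
  simp only [mul_add, Finset.sum_add_distrib]
  congr 1
  · exact Finset.sum_congr rfl fun i _ => by rw [← Finset.sum_mul, hZ.1 i]
  · rw [Finset.sum_comm]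
    exact Finset.sum_congr rfl fun j _ => by rw [← Finset.sum_mul, hZ.2 j]

lemma logLik_eq_of_mem_transport (hZ : Z ∈ transport r c) (p : (Fin m → ℝ) × (Fin n → ℝ)) :
    logLik μ r c p = ∑ i, ∑ j, (Z i j * (p.1 i + p.2 j) - psi μ (p.1 i + p.2 j)) := by
  simp only [logLik, Finset.sum_sub_distrib, sum_mul_add_eq_of_mem_transport hZ]

lemma isOpen_dualDomain (μ : Measure ℝ) (m n : ℕ) : IsOpen (dualDomain μ m n) := by
  simp only [dualDomain, Set.ofPred_forall]
  refine isOpen_iInter_of_finite fun i => isOpen_iInter_of_finite fun j => ?_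
  exact isOpen_interior.preimage (by fun_prop)

/-- First order condition: the directional derivative of the likelihood is nonpositive in every
direction in which it does not increase. -/
lemma sum_sub_psi'_mul_nonpos (hZ : Z ∈ transport r c) (hp : p ∈ dualDomain μ m n)
    (v : (Fin m → ℝ) × (Fin n → ℝ))
    (hv : ∀ᶠ τ in 𝓝[>] (0 : ℝ), logLik μ r c (p + τ • v) ≤ logLik μ r c p) :
    ∑ i, ∑ j, (Z i j - psi' μ (p.1 i + p.2 j)) * (v.1 i + v.2 j) ≤ 0 := by
  have hd : HasDerivAt (fun τ : ℝ => logLik μ r c (p + τ • v))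
      (∑ i, ∑ j, (Z i j - psi' μ (p.1 i + p.2 j)) * (v.1 i + v.2 j)) 0 := by
    simp only [logLik_eq_of_mem_transport hZ]
    refine HasDerivAt.fun_sum fun i _ => HasDerivAt.fun_sum fun j _ => ?_
    have hlin : HasDerivAt (fun τ : ℝ => (p + τ • v).1 i + (p + τ • v).2 j)
        (v.1 i + v.2 j) 0 := by
      have : HasDerivAt (fun τ : ℝ => (p.1 i + p.2 j) + τ * (v.1 i + v.2 j))
          (v.1 i + v.2 j) 0 := by
        simpa using ((hasDerivAt_id (0 : ℝ)).mul_const (v.1 i + v.2 j)).const_add (p.1 i + p.2 j)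
      refine this.congr_of_eventuallyEq (Eventually.of_forall fun τ => ?_)
      simp
      ring
    have hpsi : HasDerivAt (psi μ) (psi' μ (p.1 i + p.2 j))
        ((fun τ : ℝ => (p + τ • v).1 i + (p + τ • v).2 j) 0) := by
      simpa using hasDerivAt_psi (hp i j)
    have := (hlin.const_mul (Z i j)).sub (hpsi.comp (0 : ℝ) hlin)
    rw [sub_mul]
    exact this
  refine le_of_tendsto hd.tendsto_slope_zero_right ?_
  filter_upwards [hv, self_mem_nhdsWithin] with τ hτ hτ0
  simp only [zero_add, zero_smul, add_zero, smul_eq_mul]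
  exact mul_nonpos_of_nonneg_of_nonpos (inv_nonneg.2 (le_of_lt hτ0)) (by linarith)

lemma eventually_mem_dualDomain (hp : p ∈ dualDomain μ m n) (v : (Fin m → ℝ) × (Fin n → ℝ)) :
    ∀ᶠ τ in 𝓝[>] (0 : ℝ), p + τ • v ∈ dualDomain μ m n := by
  have hc : ContinuousAt (fun τ : ℝ => p + τ • v) 0 := by fun_prop
  exact nhdsWithin_le_nhds (hc.eventually_mem
    ((isOpen_dualDomain μ m n).mem_nhds (by simpa using hp)))

/-- The expected table of a maximum likelihood estimate has the given margins. -/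
lemma IsMLE.psi'_mem_transport (h : IsMLE μ r c p) (hZ : Z ∈ transport r c) :
    (fun i j => psi' μ (p.1 i + p.2 j) : Matrix (Fin m) (Fin n) ℝ) ∈ transport r c := by
  have key : ∀ v : (Fin m → ℝ) × (Fin n → ℝ),
      ∑ i, ∑ j, (Z i j - psi' μ (p.1 i + p.2 j)) * (v.1 i + v.2 j) ≤ 0 := fun v =>
    sum_sub_psi'_mul_nonpos hZ h.1 v
      ((eventually_mem_dualDomain h.1 v).mono fun τ hτ => h.2 hτ)
  have key0 : ∀ v : (Fin m → ℝ) × (Fin n → ℝ),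
      ∑ i, ∑ j, (Z i j - psi' μ (p.1 i + p.2 j)) * (v.1 i + v.2 j) = 0 := fun v => by
    refine le_antisymm (key v) ?_
    have := key (-v)
    simp only [Prod.fst_neg, Prod.snd_neg, Pi.neg_apply, ← neg_add, mul_neg,
      Finset.sum_neg_distrib] at this
    linarith
  constructor
  · intro i
    have := key0 (Pi.single i 1, 0)
    rw [Finset.sum_comm] at this
    simp only [Pi.zero_apply, add_zero, Pi.single_apply, mul_ite, mul_one,
      mul_zero, Finset.sum_ite_eq', Finset.mem_univ, if_true, Finset.sum_sub_distrib,
      hZ.1 i] at this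
    linarith
  · intro j
    have := key0 (0, Pi.single j 1)
    simp only [Pi.zero_apply, zero_add, Pi.single_apply, mul_ite, mul_one,
      mul_zero, Finset.sum_ite_eq', Finset.mem_univ, if_true, Finset.sum_sub_distrib,
      hZ.2 j] at this
    linarith

lemma logLik_le_of_sum_nonpos (hlt : suppInf μ < suppSup μ) (hZ : Z ∈ transport r c)
    (hp : p ∈ dualDomain μ m n) {q : (Fin m → ℝ) × (Fin n → ℝ)} (hq : q ∈ dualDomain μ m n)
    (h : ∑ i, ∑ j, (Z i j - psi' μ (p.1 i + p.2 j)) * ((q - p).1 i + (q - p).2 j) ≤ 0) :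
    logLik μ r c q ≤ logLik μ r c p := by
  rw [logLik_eq_of_mem_transport hZ, logLik_eq_of_mem_transport hZ, ← sub_nonpos,
    ← Finset.sum_sub_distrib]
  refine le_trans ?_ h
  refine Finset.sum_le_sum fun i _ => ?_
  rw [← Finset.sum_sub_distrib]
  refine Finset.sum_le_sum fun j _ => ?_
  have := psi_tangent_le hlt (hp i j) (hq i j)
  simp only [Prod.fst_sub, Prod.snd_sub, Pi.sub_apply]
  linarith

end Likelihood

section Coercive

lemma exists_forall_le_of_mul_le {f : ℝ → ℝ} {I : Set ℝ} (hI : I.OrdConnected)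
    (hf : StrictMonoOn f I) {a b z : ℝ} (hb : b ∈ I) (hab : a < b) (hz : z < f b)
    (hI' : BddAbove I → ∀ y, ∃ θ ∈ I, y ≤ f θ) (C : ℝ) :
    ∃ u ∈ I, ∀ θ ∈ I, (f θ - z) * (θ - a) ≤ C → θ ≤ u := by
  by_cases hT : max b (a + C / (f b - z)) ∈ I
  · refine ⟨_, hT, fun θ hθ h => ?_⟩
    by_contra! hlt
    have h1 : b < θ := (le_max_left _ _).trans_lt hlt
    have h2 : C / (f b - z) < θ - a := by linarith [(le_max_right _ _).trans_lt hlt]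
    rw [div_lt_iff₀ (by linarith)] at h2
    nlinarith [hf hb hθ h1]
  · have hbdd : BddAbove I := by
      refine ⟨max b (a + C / (f b - z)), fun θ hθ => ?_⟩
      by_contra! hlt
      exact hT (hI.out hb hθ ⟨le_max_left _ _, hlt.le⟩)
    obtain ⟨w, hw, hwy⟩ := hI' hbdd (z + C / (b - a))
    refine ⟨max b w, ?_, fun θ hθ h => ?_⟩
    · rcases max_choice b w with h | h <;> rw [h] <;> assumption
    by_contra! hlt
    have h1 : b < θ := (le_max_left _ _).trans_lt hlt
    have h2 : C / (b - a) < f θ - z := by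
      linarith [hf hw hθ ((le_max_right _ _).trans_lt hlt)]
    rw [div_lt_iff₀ (by linarith)] at h2
    nlinarith [hf hb hθ h1]

lemma exists_forall_ge_of_mul_le {f : ℝ → ℝ} {I : Set ℝ} (hI : I.OrdConnected)
    (hf : StrictMonoOn f I) {a b z : ℝ} (hb : b ∈ I) (hab : b < a) (hz : f b < z)
    (hI' : BddBelow I → ∀ y, ∃ θ ∈ I, f θ ≤ y) (C : ℝ) :
    ∃ u ∈ I, ∀ θ ∈ I, (f θ - z) * (θ - a) ≤ C → u ≤ θ := by
  obtain ⟨u, hu, h⟩ := exists_forall_le_of_mul_le (f := fun x => -f (-x)) (I := -I)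
    (a := -a) (b := -b) (z := -z)
    ⟨fun x hx y hy w hw => hI.out hy hx ⟨neg_le_neg hw.2, neg_le_neg hw.1⟩⟩
    (fun x hx y hy hxy => neg_lt_neg (hf hy hx (neg_lt_neg hxy)))
    (by simpa using hb) (by linarith) (by simpa using hz)
    (fun hbdd y => by
      obtain ⟨θ, hθ, hy⟩ := hI' (by simpa using hbdd.neg) (-y)
      exact ⟨-θ, by simpa using hθ, by simpa using le_neg.2 hy⟩) C
  refine ⟨-u, hu, fun θ hθ hC => ?_⟩
  have := h (-θ) (by simpa using hθ) (by simp only [neg_neg]; linarith)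
  linarith

lemma exists_forall_le_mul {f : ℝ → ℝ} {I : Set ℝ} (hf : StrictMonoOn f I) {a b : ℝ}
    (ha : a ∈ I) (hb : b ∈ I) : ∃ L, ∀ θ ∈ I, L ≤ (f θ - f b) * (θ - a) := by
  refine ⟨-(|f a - f b| * |b - a|), fun θ hθ => ?_⟩
  have h0 : 0 ≤ |f a - f b| * |b - a| := by positivity
  have hm := hf.monotoneOn
  rcases le_total θ a with h1 | h1 <;> rcases le_total θ b with h2 | h2
  · nlinarith [mul_nonneg_of_nonpos_of_nonpos (sub_nonpos.2 (hm hθ hb h2)) (sub_nonpos.2 h1)]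
  · have e1 : f θ - f b ≤ |f a - f b| := (by linarith [hm hθ ha h1] : _ ≤ f a - f b).trans
      (le_abs_self _)
    have e2 : a - θ ≤ |b - a| := by rw [abs_sub_comm]; linarith [le_abs_self (a - b)]
    nlinarith [mul_le_mul e1 e2 (sub_nonneg.2 h1) (abs_nonneg _)]
  · have e1 : f b - f θ ≤ |f a - f b| := by
      rw [abs_sub_comm]; linarith [hm ha hθ h1, le_abs_self (f b - f a)]
    have e2 : θ - a ≤ |b - a| := by linarith [le_abs_self (b - a)]
    nlinarith [mul_le_mul e1 e2 (sub_nonneg.2 h1) (abs_nonneg _)]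
  · nlinarith [mul_nonneg (sub_nonneg.2 (hm hb hθ h2)) (sub_nonneg.2 h1)]

end Coercive

namespace IsSteep

variable {μ : Measure ℝ} {z : ℝ}

lemma exists_mem_gt (h : IsSteep μ) (hz : z ∈ meanRange μ) {θ : ℝ} (hθ : θ ∈ interior (Theta μ)) :
    ∃ η ∈ interior (Theta μ), θ < η ∧ z < psi' μ η := by
  have hlt : ((max z (psi' μ θ) : ℝ) : EReal) < suppSup μ := by
    rcases max_choice z (psi' μ θ) with e | e <;> rw [e]
    exacts [hz.2, (mapsTo_psi' h.inf_lt_sup hθ).2]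
  obtain ⟨y, hy1, hy2⟩ := EReal.lt_iff_exists_real_btwn.1 hlt
  have hy : max z (psi' μ θ) < y := by exact_mod_cast hy1
  have hzy : z < y := (le_max_left _ _).trans_lt hy
  have hyr : y ∈ meanRange μ := ⟨hz.1.trans (by exact_mod_cast hzy), hy2⟩
  refine ⟨phi μ y, h.phi_mem hyr, ?_, by rwa [h.psi'_phi hyr]⟩
  rw [← (strictMonoOn_psi' h.inf_lt_sup).lt_iff_lt hθ (h.phi_mem hyr), h.psi'_phi hyr]
  exact (le_max_right _ _).trans_lt hy

lemma exists_mem_lt (h : IsSteep μ) (hz : z ∈ meanRange μ) {θ : ℝ} (hθ : θ ∈ interior (Theta μ)) :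
    ∃ η ∈ interior (Theta μ), η < θ ∧ psi' μ η < z := by
  have hlt : suppInf μ < ((min z (psi' μ θ) : ℝ) : EReal) := by
    rcases min_choice z (psi' μ θ) with e | e <;> rw [e]
    exacts [hz.1, (mapsTo_psi' h.inf_lt_sup hθ).1]
  obtain ⟨y, hy2, hy1⟩ := EReal.lt_iff_exists_real_btwn.1 hlt
  have hy : y < min z (psi' μ θ) := by exact_mod_cast hy1
  have hzy : y < z := hy.trans_le (min_le_left _ _)
  have hyr : y ∈ meanRange μ := ⟨hy2, lt_trans (by exact_mod_cast hzy) hz.2⟩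
  refine ⟨phi μ y, h.phi_mem hyr, ?_, by rwa [h.psi'_phi hyr]⟩
  rw [← (strictMonoOn_psi' h.inf_lt_sup).lt_iff_lt (h.phi_mem hyr) hθ, h.psi'_phi hyr]
  exact hy.trans_le (min_le_right _ _)

lemma exists_forall_le (h : IsSteep μ) (hz : z ∈ meanRange μ) {θ : ℝ}
    (hθ : θ ∈ interior (Theta μ)) (C : ℝ) : ∃ u ∈ interior (Theta μ),
      ∀ η ∈ interior (Theta μ), (psi' μ η - z) * (η - θ) ≤ C → η ≤ u := by
  obtain ⟨b, hb, hab, hzb⟩ := h.exists_mem_gt hz hθ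
  refine exists_forall_le_of_mul_le (convex_interior_Theta μ).ordConnected
    (strictMonoOn_psi' h.inf_lt_sup) hb hab hzb (fun hbdd y => ?_) C
  have htop := suppSup_eq_top_of_bddAbove ⟨θ, hθ⟩ hbdd
  have hy : max y z ∈ meanRange μ :=
    ⟨hz.1.trans_le (by exact_mod_cast le_max_right y z), by rw [htop]; exact EReal.coe_lt_top _⟩
  exact ⟨_, h.phi_mem hy, by rw [h.psi'_phi hy]; exact le_max_left _ _⟩

lemma exists_forall_ge (h : IsSteep μ) (hz : z ∈ meanRange μ) {θ : ℝ}
    (hθ : θ ∈ interior (Theta μ)) (C : ℝ) : ∃ u ∈ interior (Theta μ),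
      ∀ η ∈ interior (Theta μ), (psi' μ η - z) * (η - θ) ≤ C → u ≤ η := by
  obtain ⟨b, hb, hab, hzb⟩ := h.exists_mem_lt hz hθ
  refine exists_forall_ge_of_mul_le (convex_interior_Theta μ).ordConnected
    (strictMonoOn_psi' h.inf_lt_sup) hb hab hzb (fun hbdd y => ?_) C
  have hbot := suppInf_eq_bot_of_bddBelow ⟨θ, hθ⟩ hbdd
  have hy : min y z ∈ meanRange μ :=
    ⟨by rw [hbot]; exact EReal.bot_lt_coe _,
      lt_of_le_of_lt (by exact_mod_cast min_le_right y z) hz.2⟩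
  exact ⟨_, h.phi_mem hy, by rw [h.psi'_phi hy]; exact min_le_left _ _⟩

/-- A maximum likelihood estimate exists as soon as the margin is realised by a table with entries
in `(A, B)`. -/
theorem exists_isMLE (h : IsSteep μ) {m n : ℕ} (hm : 0 < m) (hn : 0 < n) {r : Fin m → ℝ}
    {c : Fin n → ℝ} {Z : Matrix (Fin m) (Fin n) ℝ} (hZ : Z ∈ transport r c)
    (hZr : ∀ i j, Z i j ∈ meanRange μ) : ∃ p, IsMLE μ r c p := by
  have hmono := strictMonoOn_psi' h.inf_lt_sup
  obtain ⟨θ, hθ⟩ := nonempty_interior_Theta h.nontrivial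
  have hL : ∀ i j, ∃ L, ∀ η ∈ interior (Theta μ), L ≤ (psi' μ η - Z i j) * (η - θ) := by
    intro i j
    obtain ⟨L, hL⟩ := exists_forall_le_mul hmono hθ (h.phi_mem (hZr i j))
    exact ⟨L, by rwa [h.psi'_phi (hZr i j)] at hL⟩
  choose L hL using hL
  choose u hu hu' using fun i j =>
    h.exists_forall_le (hZr i j) hθ (L i j - ∑ k, ∑ l, L k l)
  choose w hw hw' using fun i j =>
    h.exists_forall_ge (hZr i j) hθ (L i j - ∑ k, ∑ l, L k l)
  have hub : ∃ b ∈ interior (Theta μ), θ < b ∧ ∀ i j, u i j < b := by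
    have : Nonempty (Fin m × Fin n) := ⟨(⟨0, hm⟩, ⟨0, hn⟩)⟩
    obtain ⟨x, hx⟩ := Finite.exists_max fun x : Fin m × Fin n => u x.1 x.2
    obtain ⟨b, hb, hxb, hb'⟩ := h.exists_mem_gt (mapsTo_psi' h.inf_lt_sup hθ) (hu x.1 x.2)
    refine ⟨b, hb, (hmono.lt_iff_lt hθ hb).1 hb', fun i j => (hx (i, j)).trans_lt hxb⟩
  have hlb : ∃ a ∈ interior (Theta μ), a < θ ∧ ∀ i j, a < w i j := by
    have : Nonempty (Fin m × Fin n) := ⟨(⟨0, hm⟩, ⟨0, hn⟩)⟩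
    obtain ⟨x, hx⟩ := Finite.exists_min fun x : Fin m × Fin n => w x.1 x.2
    obtain ⟨b, hb, hxb, hb'⟩ := h.exists_mem_lt (mapsTo_psi' h.inf_lt_sup hθ) (hw x.1 x.2)
    refine ⟨b, hb, (hmono.lt_iff_lt hb hθ).1 hb', fun i j => hxb.trans_le (hx (i, j))⟩
  obtain ⟨b, hb, hθb, hub⟩ := hub
  obtain ⟨a, ha, haθ, hlb⟩ := hlb
  have hab : Set.Icc a b ⊆ interior (Theta μ) := Icc_subset_interior_Theta ha hb
  let K : Set ((Fin m → ℝ) × (Fin n → ℝ)) := {p | ∀ i j, p.1 i + p.2 j ∈ Set.Icc a b}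
  let K₀ : Set ((Fin m → ℝ) × (Fin n → ℝ)) := K ∩ {p | p.1 ⟨0, hm⟩ = 0}
  have hKsub : K ⊆ dualDomain μ m n := fun p hp i j => hab (hp i j)
  have hKclosed : IsClosed K := by
    simp only [K, Set.ofPred_forall]
    exact isClosed_iInter fun i => isClosed_iInter fun j => isClosed_Icc.preimage (by fun_prop)
  have hK₀ : IsCompact K₀ := by
    have hbox : IsCompact ((Set.univ.pi fun _ : Fin m => Set.Icc (a - b) (b - a)) ×ˢ
        (Set.univ.pi fun _ : Fin n => Set.Icc a b)) :=
      (isCompact_univ_pi fun _ => isCompact_Icc).prod (isCompact_univ_pi fun _ => isCompact_Icc)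
    refine hbox.of_isClosed_subset
      (hKclosed.inter (isClosed_eq (by fun_prop) continuous_const)) ?_
    rintro p ⟨hp, hp0⟩
    have hp0' : p.1 ⟨0, hm⟩ = 0 := hp0
    have h2 : ∀ j, p.2 j ∈ Set.Icc a b := fun j => by
      have := hp ⟨0, hm⟩ j
      rwa [hp0', zero_add] at this
    refine ⟨fun i _ => ?_, fun j _ => h2 j⟩
    have h3 := hp i ⟨0, hn⟩
    have h4 := h2 ⟨0, hn⟩
    exact ⟨by linarith [h3.1, h4.2], by linarith [h3.2, h4.1]⟩
  have hcont : ContinuousOn (logLik μ r c) K₀ := by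
    unfold logLik
    refine ContinuousOn.sub (by fun_prop) ?_
    refine continuousOn_finsetSum _ fun i _ => continuousOn_finsetSum _ fun j _ => ?_
    exact (continuousOn_psi μ).comp (by fun_prop) fun p hp => hKsub hp.1 i j
  obtain ⟨p, hpK, hpmax⟩ := hK₀.exists_isMaxOn
    ⟨(0, fun _ => θ), fun i j => by simp [haθ.le, hθb.le], by simp⟩ hcont
  have hpmax' : ∀ q ∈ K, logLik μ r c q ≤ logLik μ r c p := by
    intro q hq
    have hshift : ((fun i => q.1 i - q.1 ⟨0, hm⟩, fun j => q.2 j + q.1 ⟨0, hm⟩) :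
        (Fin m → ℝ) × (Fin n → ℝ)) ∈ K₀ :=
      ⟨fun i j => by simpa using hq i j, by simp⟩
    refine le_trans (le_of_eq ?_) (hpmax hshift)
    simp [logLik_eq_of_mem_transport hZ]
  have hpdom := hKsub hpK.1
  have hev : ∀ q : (Fin m → ℝ) × (Fin n → ℝ), (∀ᶠ τ in 𝓝[>] (0 : ℝ), p + τ • (q - p) ∈ K) →
      ∑ i, ∑ j, (Z i j - psi' μ (p.1 i + p.2 j)) * ((q - p).1 i + (q - p).2 j) ≤ 0 := fun q hq =>
    sum_sub_psi'_mul_nonpos hZ hpdom (q - p) (hq.mono fun τ hτ => hpmax' _ hτ)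
  have hbound : ∀ i j, p.1 i + p.2 j ∈ Set.Icc (w i j) (u i j) := by
    have h0 := hev (0, fun _ => θ) (by
      filter_upwards [Ioo_mem_nhdsGT (zero_lt_one (α := ℝ))] with τ hτ i j
      have h1 := hpK.1 i j
      have h2 : θ ∈ Set.Icc a b := ⟨haθ.le, hθb.le⟩
      have := (convex_Icc a b) h1 h2 (sub_nonneg.2 hτ.2.le) hτ.1.le (by ring)
      convert this using 1
      simp
      ring)
    have h1 : ∀ i j, (psi' μ (p.1 i + p.2 j) - Z i j) * (p.1 i + p.2 j - θ) ≤
        L i j - ∑ k, ∑ l, L k l := by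
      intro i j
      have hle : ∑ x : Fin m × Fin n, ((psi' μ (p.1 x.1 + p.2 x.2) - Z x.1 x.2) *
          (p.1 x.1 + p.2 x.2 - θ) - L x.1 x.2) ≤ - ∑ k, ∑ l, L k l := by
        rw [Fintype.sum_prod_type]
        simp only [Finset.sum_sub_distrib]
        have : ∑ i, ∑ j, (psi' μ (p.1 i + p.2 j) - Z i j) * (p.1 i + p.2 j - θ) ≤ 0 := by
          refine le_trans (le_of_eq ?_) h0
          refine Finset.sum_congr rfl fun i _ => Finset.sum_congr rfl fun j _ => ?_
          simp
          ring
        linarith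
      have := Finset.single_le_sum (f := fun x : Fin m × Fin n =>
        (psi' μ (p.1 x.1 + p.2 x.2) - Z x.1 x.2) * (p.1 x.1 + p.2 x.2 - θ) - L x.1 x.2)
        (fun x _ => sub_nonneg.2 (hL x.1 x.2 _ (hpdom x.1 x.2))) (Finset.mem_univ (i, j))
      linarith
    exact fun i j => ⟨hw' i j _ (hpdom i j) (h1 i j), hu' i j _ (hpdom i j) (h1 i j)⟩
  refine ⟨p, hpdom, fun q hq => logLik_le_of_sum_nonpos h.inf_lt_sup hZ hpdom hq (hev q ?_)⟩
  have hc : ContinuousAt (fun τ : ℝ => p + τ • (q - p)) 0 := by fun_prop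
  have hopen : IsOpen {p : (Fin m → ℝ) × (Fin n → ℝ) | ∀ i j, p.1 i + p.2 j ∈ Set.Ioo a b} := by
    simp only [Set.ofPred_forall]
    exact isOpen_iInter_of_finite fun i => isOpen_iInter_of_finite fun j =>
      isOpen_Ioo.preimage (by fun_prop)
  have := hc.eventually_mem (hopen.mem_nhds (show _ from fun i j => by
    simp only [zero_smul, add_zero]
    exact ⟨(hlb i j).trans_le (hbound i j).1, (hbound i j).2.trans_lt (hub i j)⟩))
  exact nhdsWithin_le_nhds (this.mono fun τ hτ i j => Set.Ioo_subset_Icc_self (hτ i j))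

end IsSteep

section EndPoints

variable {μ : Measure ℝ} {x : ℝ}

lemma mem_interior_Theta_of_phiA_lt (hx : phiA μ < x) {η : ℝ} (hη : η ∈ interior (Theta μ))
    (hxη : x ≤ η) : x ∈ interior (Theta μ) := by
  obtain ⟨_, ⟨θ, hθ, rfl⟩, hlt⟩ := sInf_lt_iff.1 hx
  exact Icc_subset_interior_Theta hθ hη ⟨(EReal.coe_lt_coe_iff.1 hlt).le, hxη⟩

lemma mem_interior_Theta_of_lt_phiB (hx : (x : EReal) < phiB μ) {η : ℝ}
    (hη : η ∈ interior (Theta μ)) (hxη : η ≤ x) : x ∈ interior (Theta μ) := by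
  obtain ⟨_, ⟨θ, hθ, rfl⟩, hlt⟩ := lt_sSup_iff.1 hx
  exact Icc_subset_interior_Theta hη hθ ⟨hxη, (EReal.coe_lt_coe_iff.1 hlt).le⟩

end EndPoints

section LogConvex

variable {μ : Measure ℝ}

lemma convexOn_add_le_add_of_shift {I : Set ℝ} {g : ℝ → ℝ} (hg : ConvexOn ℝ I g) {u x d : ℝ}
    (hu : u ∈ I) (hxd : x + d ∈ I) (hux : u ≤ x) (hd : 0 ≤ d) :
    g x + g (u + d) ≤ g u + g (x + d) := by
  rcases hd.eq_or_lt with rfl | hd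
  · simp [add_comm]
  have hpos : 0 < x - u + d := by linarith
  have e1 : d / (x - u + d) + (x - u) / (x - u + d) = 1 := by
    rw [← add_div, add_comm d, div_self hpos.ne']
  have n1 : 0 ≤ d / (x - u + d) := div_nonneg hd.le hpos.le
  have n2 : 0 ≤ (x - u) / (x - u + d) := div_nonneg (sub_nonneg.2 hux) hpos.le
  have h1 := hg.2 hu hxd n1 n2 e1
  have h2 := hg.2 hu hxd n2 n1 (by rw [add_comm, e1])
  have p1 : (d / (x - u + d)) • u + ((x - u) / (x - u + d)) • (x + d) = x := by
    simp only [smul_eq_mul]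
    field_simp
    ring
  have p2 : ((x - u) / (x - u + d)) • u + (d / (x - u + d)) • (x + d) = u + d := by
    simp only [smul_eq_mul]
    field_simp
    ring
  rw [p1] at h1
  rw [p2] at h2
  simp only [smul_eq_mul] at h1 h2
  have e2 : (x - u) / (x - u + d) = 1 - d / (x - u + d) := by linarith
  rw [e2] at h1 h2
  linarith

lemma psi''_mul_le_of_logConvex (hlt : suppInf μ < suppSup μ)
    (hlog : ConvexOn ℝ (interior (Theta μ)) (fun θ => Real.log (psi'' μ θ))) {u x d : ℝ}
    (hu : u ∈ interior (Theta μ)) (hxd : x + d ∈ interior (Theta μ)) (hux : u ≤ x) (hd : 0 ≤ d) :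
    psi'' μ (u + d) * psi'' μ x ≤ psi'' μ (x + d) * psi'' μ u := by
  have hx : x ∈ interior (Theta μ) :=
    Icc_subset_interior_Theta hu hxd ⟨hux, by linarith⟩
  have hud : u + d ∈ interior (Theta μ) :=
    Icc_subset_interior_Theta hu hxd ⟨by linarith, by linarith⟩
  have p1 := psi''_pos hlt hu
  have p2 := psi''_pos hlt hx
  have p3 := psi''_pos hlt hud
  have p4 := psi''_pos hlt hxd
  have := convexOn_add_le_add_of_shift hlog hu hxd hux hd
  rw [← Real.log_mul p2.ne' p3.ne', ← Real.log_mul p1.ne' p4.ne',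
    Real.log_le_log_iff (by positivity) (by positivity)] at this
  linarith

/-- If `ψ''` is log-convex, then shifts of `ψ'` are convex functions of `ψ'`; this is the supporting
line inequality. -/
lemma mul_sub_le_shift_sub (hlt : suppInf μ < suppSup μ)
    (hlog : ConvexOn ℝ (interior (Theta μ)) (fun θ => Real.log (psi'' μ θ))) {u x d : ℝ}
    (hu : u ∈ interior (Theta μ)) (hud : u + d ∈ interior (Theta μ))
    (hx : x ∈ interior (Theta μ)) (hxd : x + d ∈ interior (Theta μ)) (hd : 0 ≤ d) :
    psi'' μ (u + d) / psi'' μ u * (psi' μ x - psi' μ u) ≤ psi' μ (x + d) - psi' μ (u + d) := by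
  set κ := psi'' μ (u + d) / psi'' μ u with hκ
  have hder : ∀ y ∈ interior (Theta μ), y + d ∈ interior (Theta μ) →
      HasDerivAt (fun y => psi' μ (y + d) - κ * psi' μ y) (psi'' μ (y + d) - κ * psi'' μ y) y :=
    fun y hy hyd => ((hasDerivAt_psi' hyd).comp_add_const y d).sub ((hasDerivAt_psi' hy).const_mul κ)
  have hpu := psi''_pos hlt hu
  have hmem : ∀ {a b y : ℝ}, a ∈ interior (Theta μ) → a + d ∈ interior (Theta μ) →
      b ∈ interior (Theta μ) → b + d ∈ interior (Theta μ) → y ∈ Set.Icc a b →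
      y ∈ interior (Theta μ) ∧ y + d ∈ interior (Theta μ) := fun ha had hb hbd hy =>
    ⟨Icc_subset_interior_Theta ha hb hy,
      Icc_subset_interior_Theta had hbd ⟨by linarith [hy.1], by linarith [hy.2]⟩⟩
  suffices h : psi' μ (u + d) - κ * psi' μ u ≤ psi' μ (x + d) - κ * psi' μ x by linarith
  rcases le_total u x with hux | hxu
  · have hm : MonotoneOn (fun y => psi' μ (y + d) - κ * psi' μ y) (Set.Icc u x) := by
      refine monotoneOn_of_deriv_nonneg (convex_Icc u x) (fun y hy => ?_) (fun y hy => ?_)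
        (fun y hy => ?_)
      · obtain ⟨h1, h2⟩ := hmem hu hud hx hxd hy
        exact (hder y h1 h2).continuousAt.continuousWithinAt
      · obtain ⟨h1, h2⟩ := hmem hu hud hx hxd (interior_subset hy)
        exact (hder y h1 h2).differentiableAt.differentiableWithinAt
      · obtain ⟨h1, h2⟩ := hmem hu hud hx hxd (interior_subset hy)
        rw [(hder y h1 h2).deriv, sub_nonneg, hκ, div_mul_eq_mul_div, div_le_iff₀ hpu]
        exact psi''_mul_le_of_logConvex hlt hlog hu h2 (interior_subset hy).1 hd
    exact hm (Set.left_mem_Icc.2 hux) (Set.right_mem_Icc.2 hux) hux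
  · have hm : AntitoneOn (fun y => psi' μ (y + d) - κ * psi' μ y) (Set.Icc x u) := by
      refine antitoneOn_of_deriv_nonpos (convex_Icc x u) (fun y hy => ?_) (fun y hy => ?_)
        (fun y hy => ?_)
      · obtain ⟨h1, h2⟩ := hmem hx hxd hu hud hy
        exact (hder y h1 h2).continuousAt.continuousWithinAt
      · obtain ⟨h1, h2⟩ := hmem hx hxd hu hud (interior_subset hy)
        exact (hder y h1 h2).differentiableAt.differentiableWithinAt
      · obtain ⟨h1, h2⟩ := hmem hx hxd hu hud (interior_subset hy)
        rw [(hder y h1 h2).deriv, sub_nonpos, hκ, div_mul_eq_mul_div, le_div_iff₀ hpu]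
        exact psi''_mul_le_of_logConvex hlt hlog h1 hud (interior_subset hy).2 hd
    exact hm (Set.left_mem_Icc.2 hxu) (Set.right_mem_Icc.2 hxu) hxu

/-- If `ψ''` is monotone, then the support is unbounded above. -/
lemma suppSup_eq_top_of_monotoneOn (hlt : suppInf μ < suppSup μ)
    (hne : (interior (Theta μ)).Nonempty) (hmon : MonotoneOn (psi'' μ) (interior (Theta μ))) :
    suppSup μ = ⊤ := by
  by_cases hbdd : BddAbove (interior (Theta μ))
  · exact suppSup_eq_top_of_bddAbove hne hbdd
  obtain ⟨θ, hθ⟩ := hne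
  by_contra hB
  obtain ⟨M, hM1, -⟩ := EReal.lt_iff_exists_real_btwn.1 (lt_top_iff_ne_top.2 hB)
  have hpos := psi''_pos hlt hθ
  have hgrow : ∀ η ∈ interior (Theta μ), θ ≤ η →
      psi'' μ θ * (η - θ) ≤ psi' μ η - psi' μ θ := by
    intro η hη hle
    have hsub := Icc_subset_interior_Theta hθ hη
    refine (convex_Icc θ η).mul_sub_le_image_sub_of_le_deriv ((continuousOn_psi' μ).mono hsub)
      (fun y hy => (hasDerivAt_psi' (hsub (interior_subset hy))).differentiableAt
        |>.differentiableWithinAt) (fun y hy => ?_) θ (Set.left_mem_Icc.2 hle) η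
        (Set.right_mem_Icc.2 hle) hle
    rw [(hasDerivAt_psi' (hsub (interior_subset hy))).deriv]
    exact hmon hθ (hsub (interior_subset hy)) (interior_subset hy).1
  obtain ⟨η, hη, hlarge⟩ := not_bddAbove_iff.1 hbdd
    (max θ (θ + (M - psi' μ θ) / psi'' μ θ))
  have h1 := hgrow η hη ((le_max_left _ _).trans hlarge.le)
  have h2 : (M - psi' μ θ) / psi'' μ θ < η - θ := by
    linarith [(le_max_right θ (θ + (M - psi' μ θ) / psi'' μ θ)).trans_lt hlarge]
  rw [div_lt_iff₀ hpos] at h2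
  have h3 : psi' μ η < M := by
    exact_mod_cast (psi'_le_suppSup (ne_zero_of_suppInf_lt_suppSup hlt) hη).trans_lt hM1
  linarith

end LogConvex

namespace IsSteep

variable {μ : Measure ℝ}

/-- Two lines of a table whose means lie in `[s, t]` have parameters at most `φ(t) - φ(s)`
apart. -/
lemma sub_le_phi_sub_phi (h : IsSteep μ)
    (hlog : ConvexOn ℝ (interior (Theta μ)) (fun θ => Real.log (psi'' μ θ))) {n : ℕ} (hn : 0 < n)
    {b : Fin n → ℝ} {x y s t : ℝ} (hs : s ∈ meanRange μ) (ht : t ∈ meanRange μ) (hxy : x ≤ y)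
    (hx : ∀ j, x + b j ∈ interior (Theta μ)) (hy : ∀ j, y + b j ∈ interior (Theta μ))
    (hsx : n * s ≤ ∑ j, psi' μ (x + b j)) (hty : ∑ j, psi' μ (y + b j) ≤ n * t) :
    y - x ≤ phi μ t - phi μ s := by
  have hmono := (strictMonoOn_psi' h.inf_lt_sup).monotoneOn
  have hn' : (0 : ℝ) < n := by exact_mod_cast hn
  have : Nonempty (Fin n) := ⟨⟨0, hn⟩⟩
  obtain ⟨k, hk⟩ := Finite.exists_min b
  obtain ⟨l, hl⟩ := Finite.exists_max b
  have hkl : x + b k ≤ x + b l := by linarith [hk l]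
  obtain ⟨u, hu, hfu⟩ := intermediate_value_Icc hkl
    ((continuousOn_psi' μ).mono (Icc_subset_interior_Theta (hx k) (hx l)))
    (show (∑ j, psi' μ (x + b j)) / n ∈ _ from by
      refine ⟨(le_div_iff₀ hn').2 ?_, (div_le_iff₀ hn').2 ?_⟩
      · have := Finset.card_nsmul_le_sum Finset.univ (fun j => psi' μ (x + b j))
          (psi' μ (x + b k)) fun j _ => hmono (hx k) (hx j) (by linarith [hk j])
        simp only [Finset.card_univ, Fintype.card_fin, nsmul_eq_mul] at this
        linarith
      · have := Finset.sum_le_card_nsmul Finset.univ (fun j => psi' μ (x + b j))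
          (psi' μ (x + b l)) fun j _ => hmono (hx j) (hx l) (by linarith [hl j])
        simp only [Finset.card_univ, Fintype.card_fin, nsmul_eq_mul] at this
        linarith)
  have huI := Icc_subset_interior_Theta (hx k) (hx l) hu
  have hudI : u + (y - x) ∈ interior (Theta μ) :=
    Icc_subset_interior_Theta (hy k) (hy l) ⟨by linarith [hu.1], by linarith [hu.2]⟩
  have hfu' : ∑ j, psi' μ (x + b j) = n * psi' μ u := by rw [hfu]; field_simp
  have hsum : ∑ j, psi'' μ (u + (y - x)) / psi'' μ u * (psi' μ (x + b j) - psi' μ u) ≤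
      ∑ j, (psi' μ (y + b j) - psi' μ (u + (y - x))) := by
    refine Finset.sum_le_sum fun j _ => ?_
    have e : x + b j + (y - x) = y + b j := by ring
    have := mul_sub_le_shift_sub h.inf_lt_sup hlog huI hudI (hx j) (by rw [e]; exact hy j)
      (sub_nonneg.2 hxy)
    rwa [e] at this
  rw [← Finset.mul_sum] at hsum
  simp only [Finset.sum_sub_distrib, hfu', Finset.sum_const, Finset.card_univ, Fintype.card_fin,
    nsmul_eq_mul, sub_self, mul_zero] at hsum
  have h1 : psi' μ (u + (y - x)) ≤ t := le_of_mul_le_mul_left (by linarith) hn'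
  have h2 : s ≤ psi' μ u := le_of_mul_le_mul_left (by linarith) hn'
  rw [h.psi'_le_iff hudI ht] at h1
  rw [h.le_psi'_iff huI hs] at h2
  linarith

end IsSteep

lemma exists_tame_constant {μ : Measure ℝ} {x y : ℝ} (hx : suppInf μ < x)
    (hy : (y : EReal) < suppSup μ) : ∃ δ : ℝ, 0 < δ ∧ ∀ z : ℝ, x ≤ z → z ≤ y →
      max (suppInf μ + (δ : EReal)) ((-(1 / δ) : ℝ) : EReal) ≤ (z : EReal) ∧
      (z : EReal) ≤ min (suppSup μ - (δ : EReal)) ((1 / δ : ℝ) : EReal) := by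
  obtain ⟨a, ha, hax⟩ := EReal.lt_iff_exists_real_btwn.1 hx
  obtain ⟨b, hyb, hb⟩ := EReal.lt_iff_exists_real_btwn.1 hy
  have hax' : a < x := by exact_mod_cast hax
  have hyb' : y < b := by exact_mod_cast hyb
  have hM : 0 < |x| + |y| + 1 := by positivity
  refine ⟨min (min (x - a) (b - y)) (1 / (|x| + |y| + 1)),
    lt_min (lt_min (by linarith) (by linarith)) (by positivity), fun z hxz hzy => ?_⟩
  set δ := min (min (x - a) (b - y)) (1 / (|x| + |y| + 1))
  have hδ : 0 < δ := lt_min (lt_min (by linarith) (by linarith)) (by positivity)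
  have h1 : δ ≤ x - a := (min_le_left _ _).trans (min_le_left _ _)
  have h2 : δ ≤ b - y := (min_le_left _ _).trans (min_le_right _ _)
  have h3 : |x| + |y| + 1 ≤ 1 / δ := by
    rw [le_div_iff₀ hδ, ← le_div_iff₀' hM]
    exact min_le_right _ _
  refine ⟨max_le ?_ ?_, le_min ?_ ?_⟩
  · calc suppInf μ + (δ : EReal) ≤ (a : EReal) + (δ : EReal) := by gcongr
      _ ≤ z := by
        rw [← EReal.coe_add, EReal.coe_le_coe_iff]
        linarith
  · rw [EReal.coe_le_coe_iff]
    linarith [neg_abs_le x, abs_nonneg y]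
  · calc (z : EReal) ≤ (b : EReal) - (δ : EReal) := by
          rw [← EReal.coe_sub, EReal.coe_le_coe_iff]
          linarith
      _ ≤ suppSup μ - (δ : EReal) := EReal.sub_le_sub hb.le le_rfl
  · rw [EReal.coe_le_coe_iff]
    linarith [le_abs_self y, abs_nonneg x]

namespace IsSteep

variable {μ : Measure ℝ}

theorem mem_Omega (h : IsSteep μ)
    (hlog : ConvexOn ℝ (interior (Theta μ)) (fun θ => Real.log (psi'' μ θ))) {s t : ℝ}
    (hs : s ∈ meanRange μ) (ht : t ∈ meanRange μ) (hst : s ≤ t)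
    (hA : phiA μ < ((3 * phi μ s - 2 * phi μ t : ℝ) : EReal))
    (hB : ((2 * phi μ t - phi μ s : ℝ) : EReal) < phiB μ) : (s, t) ∈ Omega μ := by
  have hmono := (strictMonoOn_psi' h.inf_lt_sup).monotoneOn
  have hphi := h.phi_mono hs ht hst
  have hlo := mem_interior_Theta_of_phiA_lt hA (h.phi_mem hs) (by linarith)
  have hhi := mem_interior_Theta_of_lt_phiB hB (h.phi_mem ht) (by linarith)
  obtain ⟨δ, hδ, hδ'⟩ := exists_tame_constant (mapsTo_psi' h.inf_lt_sup hlo).1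
    (mapsTo_psi' h.inf_lt_sup hhi).2
  refine ⟨hs, ht, hst, δ, hδ, fun m n hm hn r c ⟨⟨Z, hZ, hZr⟩, hr, hc⟩ => ?_⟩
  obtain ⟨p, hp⟩ := h.exists_isMLE hm hn hZ hZr
  have hT := hp.psi'_mem_transport hZ
  have hdom := hp.1
  have hm' : (0 : ℝ) < m := by exact_mod_cast hm
  have hn' : (0 : ℝ) < n := by exact_mod_cast hn
  have : Nonempty (Fin m) := ⟨⟨0, hm⟩⟩
  have : Nonempty (Fin n) := ⟨⟨0, hn⟩⟩
  obtain ⟨i₀, hi₀⟩ := Finite.exists_min p.1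
  obtain ⟨i₁, hi₁⟩ := Finite.exists_max p.1
  obtain ⟨j₀, hj₀⟩ := Finite.exists_min p.2
  obtain ⟨j₁, hj₁⟩ := Finite.exists_max p.2
  have hr1 : ∀ i, n * s ≤ ∑ j, psi' μ (p.1 i + p.2 j) := fun i => by
    rw [hT.1 i, ← le_div_iff₀' hn']; exact (hr i).1
  have hr2 : ∀ i, ∑ j, psi' μ (p.1 i + p.2 j) ≤ n * t := fun i => by
    rw [hT.1 i, ← div_le_iff₀' hn']; exact (hr i).2
  have hc1 : ∀ j, m * s ≤ ∑ i, psi' μ (p.1 i + p.2 j) := fun j => by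
    rw [hT.2 j, ← le_div_iff₀' hm']; exact (hc j).1
  have hc2 : ∀ j, ∑ i, psi' μ (p.1 i + p.2 j) ≤ m * t := fun j => by
    rw [hT.2 j, ← div_le_iff₀' hm']; exact (hc j).2
  have hrow : p.1 i₁ - p.1 i₀ ≤ phi μ t - phi μ s :=
    h.sub_le_phi_sub_phi hlog hn hs ht (hi₀ i₁) (hdom i₀) (hdom i₁) (hr1 i₀) (hr2 i₁)
  have hcol : p.2 j₁ - p.2 j₀ ≤ phi μ t - phi μ s :=
    h.sub_le_phi_sub_phi hlog hm hs ht (hj₀ j₁) (b := p.1)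
      (fun i => by rw [add_comm]; exact hdom i j₀) (fun i => by rw [add_comm]; exact hdom i j₁)
      (by simpa only [add_comm] using hc1 j₀) (by simpa only [add_comm] using hc2 j₁)
  have hmix : p.1 i₀ + p.2 j₁ ≤ phi μ t := by
    rw [← h.psi'_le_iff (hdom i₀ j₁) ht]
    have := Finset.card_nsmul_le_sum Finset.univ (fun i => psi' μ (p.1 i + p.2 j₁))
      (psi' μ (p.1 i₀ + p.2 j₁)) fun i _ => hmono (hdom _ _) (hdom _ _) (by linarith [hi₀ i])
    simp only [Finset.card_univ, Fintype.card_fin, nsmul_eq_mul] at this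
    exact le_of_mul_le_mul_left (this.trans (hc2 j₁)) hm'
  have htop : phi μ s ≤ p.1 i₁ + p.2 j₁ := by
    rw [← h.le_psi'_iff (hdom i₁ j₁) hs]
    have := Finset.sum_le_card_nsmul Finset.univ (fun i => psi' μ (p.1 i + p.2 j₁))
      (psi' μ (p.1 i₁ + p.2 j₁)) fun i _ => hmono (hdom _ _) (hdom _ _) (by linarith [hi₁ i])
    simp only [Finset.card_univ, Fintype.card_fin, nsmul_eq_mul] at this
    exact le_of_mul_le_mul_left ((hc1 j₁).trans this) hm'
  refine ⟨p, hp, fun i j => hδ' _ (hmono hlo (hdom i j) ?_) (hmono (hdom i j) hhi ?_)⟩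
  · linarith [hi₀ i, hj₀ j]
  · linarith [hi₁ i, hj₁ j]

end IsSteep

section Block

/-- The margin `(t (N + 1), s (N + 1), …, s (N + 1))`. -/
noncomputable def blockMargin (s t : ℝ) (N : ℕ) : Fin (N + 1) → ℝ :=
  Fin.cons (t * (N + 1)) fun _ => s * (N + 1)

variable {μ : Measure ℝ} {s t : ℝ}

lemma marginWithin_blockMargin (hs : s ∈ meanRange μ) (hst : s ≤ t) (htop : suppSup μ = ⊤)
    (N : ℕ) : MarginWithin μ s t (blockMargin s t N) (blockMargin s t N) := by
  have hN : (0 : ℝ) < N + 1 := by positivity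
  have hbd : ∀ i, s ≤ blockMargin s t N i / ((N + 1 : ℕ) : ℝ) ∧
      blockMargin s t N i / ((N + 1 : ℕ) : ℝ) ≤ t := by
    intro i
    push_cast
    refine Fin.cases ?_ (fun i => ?_) i <;>
      simp [blockMargin, mul_div_cancel_right₀ _ hN.ne', hst]
  refine ⟨⟨Fin.cons (Fin.cons (t + N * (t - s)) fun _ => s) fun _ _ => s, ⟨?_, ?_⟩, ?_⟩, hbd, hbd⟩
  · intro i
    refine Fin.cases ?_ (fun i => ?_) i
    · simp [blockMargin, Fin.sum_univ_succ]
      ring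
    · simp [blockMargin]
      ring
  · intro j
    refine Fin.cases ?_ (fun j => ?_) j
    · simp [blockMargin, Fin.sum_univ_succ]
      ring
    · simp [blockMargin, Fin.sum_univ_succ]
      ring
  · have hmem : ∀ y : ℝ, s ≤ y → y ∈ meanRange μ := fun y hy =>
      ⟨hs.1.trans_le (by exact_mod_cast hy), by rw [htop]; exact EReal.coe_lt_top y⟩
    intro i j
    refine hmem _ ?_
    refine Fin.cases ?_ (fun i => ?_) i
    · refine Fin.cases ?_ (fun j => ?_) j
      · simp only [Fin.cons_zero]
        nlinarith [mul_nonneg (Nat.cast_nonneg (α := ℝ) N) (sub_nonneg.2 hst)]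
      · simp
    · simp

namespace IsSteep

lemma eq_of_sum_psi'_eq (h : IsSteep μ) {n : ℕ} (hn : 0 < n) {b : Fin n → ℝ} {x y : ℝ}
    (hx : ∀ j, x + b j ∈ interior (Theta μ)) (hy : ∀ j, y + b j ∈ interior (Theta μ))
    (heq : ∑ j, psi' μ (x + b j) = ∑ j, psi' μ (y + b j)) : x = y := by
  have hmono := strictMonoOn_psi' h.inf_lt_sup
  have : Nonempty (Fin n) := ⟨⟨0, hn⟩⟩
  rcases lt_trichotomy x y with hlt | heq' | hlt
  · exact absurd heq (Finset.sum_lt_sum_of_nonempty Finset.univ_nonempty fun j _ =>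
      hmono (hx j) (hy j) (by linarith)).ne
  · exact heq'
  · exact absurd heq (Finset.sum_lt_sum_of_nonempty Finset.univ_nonempty fun j _ =>
      hmono (hy j) (hx j) (by linarith)).ne'

/-- The corner entry of the expected table of a block margin is unbounded if
`φ(B) < 2 φ(t) - φ(s)`. -/
lemma eventually_lt_abs_corner (h : IsSteep μ) (hs : s ∈ meanRange μ) (ht : t ∈ meanRange μ)
    (hB : phiB μ < ((2 * phi μ t - phi μ s : ℝ) : EReal)) (K : ℝ) :
    ∀ᶠ N : ℕ in atTop, ∀ p ∈ dualDomain μ (N + 1) (N + 1),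
      (fun i j => psi' μ (p.1 i + p.2 j) : Matrix (Fin (N + 1)) (Fin (N + 1)) ℝ) ∈
        transport (blockMargin s t N) (blockMargin s t N) →
      K < |psi' μ (p.1 0 + p.2 0)| := by
  have hmono := strictMonoOn_psi' h.inf_lt_sup
  obtain ⟨b, hb1, hb2⟩ := EReal.lt_iff_exists_real_btwn.1 hB
  have hb : ∀ θ ∈ interior (Theta μ), θ < b := fun θ hθ => by
    have : (θ : EReal) ≤ phiB μ := le_sSup ⟨θ, hθ, rfl⟩
    exact_mod_cast this.trans_lt hb1
  have hb2' : b < 2 * phi μ t - phi μ s := by exact_mod_cast hb2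
  obtain ⟨ε, hε, hu, hw, hε'⟩ : ∃ ε : ℝ, 0 < ε ∧ phi μ t - ε ∈ interior (Theta μ) ∧
      phi μ s + ε ∈ interior (Theta μ) ∧ b < 2 * phi μ t - phi μ s - 3 * ε := by
    have c1 : ContinuousAt (fun ε : ℝ => phi μ t - ε) 0 := by fun_prop
    have c2 : ContinuousAt (fun ε : ℝ => phi μ s + ε) 0 := by fun_prop
    have c3 : ContinuousAt (fun ε : ℝ => 2 * phi μ t - phi μ s - 3 * ε) 0 := by fun_prop
    have e1 := c1.eventually_mem (isOpen_interior.mem_nhds (by simpa using h.phi_mem ht))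
    have e2 := c2.eventually_mem (isOpen_interior.mem_nhds (by simpa using h.phi_mem hs))
    have e3 := c3.eventually_mem (isOpen_Ioi.mem_nhds (show _ ∈ Set.Ioi b by simpa using hb2'))
    have e := (eventually_mem_nhdsWithin (a := (0 : ℝ)) (s := Set.Ioi 0)).and
      (nhdsWithin_le_nhds (e1.and (e2.and e3)))
    exact e.exists
  have hfu : psi' μ (phi μ t - ε) < t := by
    have := hmono hu (h.phi_mem ht) (by linarith)
    rwa [h.psi'_phi ht] at this
  have hfw : s < psi' μ (phi μ s + ε) := by
    have := hmono (h.phi_mem hs) hw (by linarith)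
    rwa [h.psi'_phi hs] at this
  have l1 : Tendsto (fun N : ℕ => (N : ℝ) * (t - psi' μ (phi μ t - ε))) atTop atTop :=
    tendsto_natCast_atTop_atTop.atTop_mul_const (by linarith)
  have l2 : Tendsto (fun N : ℕ => (N : ℝ) * (psi' μ (phi μ s + ε) - s)) atTop atTop :=
    tendsto_natCast_atTop_atTop.atTop_mul_const (by linarith)
  filter_upwards [eventually_gt_atTop 0, l1.eventually_ge_atTop (K - t),
    l2.eventually_ge_atTop (s - psi' μ (phi μ t - ε))] with N hN h1 h2 p hp hT
  by_contra! hK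
  have hN' : (0 : ℝ) < N := by exact_mod_cast hN
  let k : Fin (N + 1) := Fin.succ ⟨0, hN⟩
  have hα : ∀ i : Fin N, p.1 i.succ = p.1 k := fun i =>
    h.eq_of_sum_psi'_eq (Nat.succ_pos N) (hp _) (hp _)
      (by rw [hT.1 i.succ, hT.1 k]; rfl)
  have hβ : ∀ j : Fin N, p.2 j.succ = p.2 k := fun j =>
    h.eq_of_sum_psi'_eq (Nat.succ_pos N) (b := p.1) (fun i => by rw [add_comm]; exact hp i _)
      (fun i => by rw [add_comm]; exact hp i _) (by
        have := (hT.2 j.succ).trans ((show blockMargin s t N j.succ = blockMargin s t N k from rfl).trans (hT.2 k).symm)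
        simpa only [add_comm] using this)
  have r0 := hT.1 0
  have rk := hT.1 k
  have c0 := hT.2 0
  simp only [Fin.sum_univ_succ, hα, hβ, Finset.sum_const, Finset.card_univ, Fintype.card_fin,
    nsmul_eq_mul] at r0 rk c0
  simp only [blockMargin, k, Fin.cons_zero, Fin.cons_succ] at r0 rk c0
  have hz : psi' μ (p.1 0 + p.2 0) ≤ K := (le_abs_self _).trans hK
  have z01 : psi' μ (phi μ t - ε) ≤ psi' μ (p.1 0 + p.2 k) :=
    le_of_mul_le_mul_left (by simp only [k]; linarith) hN'
  have z10 : psi' μ (phi μ t - ε) ≤ psi' μ (p.1 k + p.2 0) :=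
    le_of_mul_le_mul_left (by simp only [k]; linarith) hN'
  have z11 : psi' μ (p.1 k + p.2 k) ≤ psi' μ (phi μ s + ε) :=
    le_of_mul_le_mul_left (by simp only [k] at z10 ⊢; linarith) hN'
  rw [hmono.le_iff_le hu (hp _ _)] at z01 z10
  rw [hmono.le_iff_le (hp _ _) hw] at z11
  linarith [hb _ (hp 0 0)]

lemma suppSup_eq_top_of_phiB_lt (h : IsSteep μ) {x : ℝ} (hx : phiB μ < (x : EReal)) :
    suppSup μ = ⊤ := by
  refine suppSup_eq_top_of_bddAbove (nonempty_interior_Theta h.nontrivial) ⟨x, fun θ hθ => ?_⟩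
  have : (θ : EReal) ≤ phiB μ := le_sSup ⟨θ, hθ, rfl⟩
  exact_mod_cast this.trans hx.le

theorem notMem_Omega (h : IsSteep μ) (hs : s ∈ meanRange μ) (ht : t ∈ meanRange μ) (hst : s ≤ t)
    (hB : phiB μ < ((2 * phi μ t - phi μ s : ℝ) : EReal)) : (s, t) ∉ Omega μ := by
  rintro ⟨-, -, -, δ, -, htame⟩
  obtain ⟨N, hN⟩ := (h.eventually_lt_abs_corner hs ht hB (1 / δ)).exists
  have hw := marginWithin_blockMargin hs hst (h.suppSup_eq_top_of_phiB_lt hB) N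
  obtain ⟨p, hp, hpδ⟩ := htame (N + 1) (N + 1) N.succ_pos N.succ_pos _ _ hw
  obtain ⟨Z, hZ, -⟩ := hw.1
  have := hN p hp.1 (hp.psi'_mem_transport hZ)
  obtain ⟨h1, h2⟩ := hpδ 0 0
  have h1' := (le_max_right _ _).trans h1
  have h2' := h2.trans (min_le_right _ _)
  rw [EReal.coe_le_coe_iff] at h1' h2'
  exact absurd (abs_le.2 ⟨h1', h2'⟩) (not_le.2 this)

end IsSteep

end Block

section Entropy

variable {μ : Measure ℝ}

lemma sigmaFinite_of_mem_Theta {θ : ℝ} (hθ : θ ∈ Theta μ) : SigmaFinite μ := by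
  have hint : Integrable (fun x => Real.exp (θ * x)) μ := hθ
  have : IsLocallyFiniteMeasure μ := by
    refine ⟨fun x => ⟨{y | Real.exp (θ * x) / 2 ≤ ‖Real.exp (θ * y)‖}, ?_, ?_⟩⟩
    · have hc : ContinuousAt (fun y : ℝ => ‖Real.exp (θ * y)‖) x := by fun_prop
      have := hc.eventually_mem (isOpen_Ioi.mem_nhds
        (show _ ∈ Set.Ioi (Real.exp (θ * x) / 2) by
          rw [Set.mem_Ioi, Real.norm_eq_abs, Real.abs_exp]
          linarith [Real.exp_pos (θ * x)]))
      exact this.mono fun y hy => le_of_lt hy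
    · exact hint.measure_norm_ge_lt_top (by positivity)
  infer_instance

lemma integral_llr_tilt [SigmaFinite μ] (hμ : μ ≠ 0) {θ : ℝ} (hθ : θ ∈ interior (Theta μ)) :
    ∫ x, llr (tilt μ θ) μ x ∂(tilt μ θ) = θ * psi' μ θ - psi μ θ := by
  have := isProbabilityMeasure_tilt hμ hθ
  have hae : llr (tilt μ θ) μ =ᵐ[tilt μ θ] fun x => θ * x - psi μ θ :=
    (tilted_absolutelyContinuous _ _).ae_le
      (log_rnDeriv_tilted_left_self (integrable_exp_of_mem hθ))
  rw [integral_congr_ae hae, integral_sub ((integrable_id_tilt hμ hθ).const_mul θ)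
    (integrable_const _), integral_const_mul, integral_tilt hθ]
  simp

lemma coe_sum_ereal {ι : Type*} (S : Finset ι) (f : ι → ℝ) :
    ((∑ i ∈ S, f i : ℝ) : EReal) = ∑ i ∈ S, (f i : EReal) :=
  map_sum (⟨⟨fun x : ℝ => (x : EReal), EReal.coe_zero⟩, EReal.coe_add⟩ : ℝ →+ EReal) f S

namespace IsSteep

lemma sigmaFinite (h : IsSteep μ) : SigmaFinite μ :=
  sigmaFinite_of_mem_Theta h.nontrivial.nonempty.some_mem

lemma relEntropy_psi' (h : IsSteep μ) {θ : ℝ} (hθ : θ ∈ interior (Theta μ)) :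
    relEntropy μ (psi' μ θ) = ((psi' μ θ * θ - psi μ θ : ℝ) : EReal) := by
  have := h.sigmaFinite
  rw [relEntropy, if_pos (mapsTo_psi' h.inf_lt_sup hθ), h.phi_psi' hθ,
    integral_llr_tilt (ne_zero_of_suppInf_lt_suppSup h.inf_lt_sup) hθ, mul_comm]

lemma le_relEntropy (h : IsSteep μ) {θ : ℝ} (hθ : θ ∈ interior (Theta μ)) (z : ℝ) :
    ((z * θ - psi μ θ : ℝ) : EReal) ≤ relEntropy μ z := by
  by_cases hz : z ∈ meanRange μ
  · have := h.relEntropy_psi' (h.phi_mem hz)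
    rw [h.psi'_phi hz] at this
    rw [this, EReal.coe_le_coe_iff]
    have := psi_tangent_le h.inf_lt_sup (h.phi_mem hz) hθ
    rw [h.psi'_phi hz] at this
    linarith
  · rw [relEntropy, if_neg hz]
    exact le_top

lemma isTypicalTable_of_isMLE (h : IsSteep μ) {m n : ℕ} {r : Fin m → ℝ} {c : Fin n → ℝ}
    {Z : Matrix (Fin m) (Fin n) ℝ} (hZ : Z ∈ transport r c)
    {p : (Fin m → ℝ) × (Fin n → ℝ)} (hp : IsMLE μ r c p) :
    IsTypicalTable μ r c (fun i j => psi' μ (p.1 i + p.2 j)) := by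
  have hT := hp.psi'_mem_transport hZ
  have hval : tableEntropy μ (fun i j => psi' μ (p.1 i + p.2 j) : Matrix (Fin m) (Fin n) ℝ) =
      ((logLik μ r c p : ℝ) : EReal) := by
    rw [logLik_eq_of_mem_transport hT]
    simp only [tableEntropy, coe_sum_ereal]
    exact Finset.sum_congr rfl fun i _ => Finset.sum_congr rfl fun j _ =>
      h.relEntropy_psi' (hp.1 i j)
  refine ⟨hT, by rw [hval]; exact EReal.coe_lt_top _, fun W hW => ?_⟩
  change tableEntropy μ (fun i j => psi' μ (p.1 i + p.2 j) : Matrix (Fin m) (Fin n) ℝ) ≤ _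
  rw [hval, logLik_eq_of_mem_transport hW]
  simp only [tableEntropy, coe_sum_ereal]
  exact Finset.sum_le_sum fun i _ => Finset.sum_le_sum fun j _ => h.le_relEntropy (hp.1 i j) _

theorem typicalTablesBlowUp (h : IsSteep μ) (h0 : 0 ≤ suppInf μ) {s t : ℝ} (hs : s ∈ meanRange μ)
    (ht : t ∈ meanRange μ) (hst : s ≤ t)
    (hB : phiB μ < ((2 * phi μ t - phi μ s : ℝ) : EReal)) : TypicalTablesBlowUp μ s t := by
  have hw := marginWithin_blockMargin hs hst (h.suppSup_eq_top_of_phiB_lt hB)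
  have hex : ∀ N, ∃ p, IsMLE μ (blockMargin s t N) (blockMargin s t N) p := fun N => by
    obtain ⟨Z, hZ, hZr⟩ := (hw N).1
    exact h.exists_isMLE N.succ_pos N.succ_pos hZ hZr
  choose p hp using hex
  refine ⟨blockMargin s t, blockMargin s t, fun N i j => psi' μ ((p N).1 i + (p N).2 j),
    fun N => ⟨hw N, ?_⟩, tendsto_atTop.2 fun K => ?_⟩
  · obtain ⟨Z, hZ, -⟩ := (hw N).1
    exact h.isTypicalTable_of_isMLE hZ (hp N)
  · filter_upwards [h.eventually_lt_abs_corner hs ht hB K] with N hN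
    obtain ⟨Z, hZ, -⟩ := (hw N).1
    have := hN (p N) (hp N).1 ((hp N).psi'_mem_transport hZ)
    have hpos : (0 : EReal) ≤ (psi' μ ((p N).1 0 + (p N).2 0) : EReal) :=
      h0.trans (suppInf_le_psi' (ne_zero_of_suppInf_lt_suppSup h.inf_lt_sup) ((hp N).1 0 0))
    rw [abs_of_nonneg (by exact_mod_cast hpos)] at this
    exact this.le

end IsSteep

end Entropy

section Explicit

variable {μ : Measure ℝ} {θ : ℝ} {g : ℝ → ℝ}

lemma psi'_eq_of_hasDerivAt (hg : ∀ η ∈ interior (Theta μ), psi μ η = g η)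
    (hθ : θ ∈ interior (Theta μ)) {y : ℝ} (hd : HasDerivAt g y θ) : psi' μ θ = y :=
  (hd.congr_of_eventuallyEq
    (Filter.mem_of_superset (isOpen_interior.mem_nhds hθ) fun η hη => hg η hη)).deriv

lemma psi''_eq_of_hasDerivAt (hg : ∀ η ∈ interior (Theta μ), psi' μ η = g η)
    (hθ : θ ∈ interior (Theta μ)) {y : ℝ} (hd : HasDerivAt g y θ) : psi'' μ θ = y :=
  (hasDerivAt_psi' hθ).unique (hd.congr_of_eventuallyEq
    (Filter.mem_of_superset (isOpen_interior.mem_nhds hθ) fun η hη => hg η hη))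

lemma phiA_lt_of_mem (hθ : θ ∈ interior (Theta μ)) {x : ℝ} (h : θ < x) : phiA μ < x :=
  (sInf_le (Set.mem_image_of_mem _ hθ)).trans_lt (EReal.coe_lt_coe_iff.2 h)

lemma lt_phiB_of_mem (hθ : θ ∈ interior (Theta μ)) {x : ℝ} (h : x < θ) : (x : EReal) < phiB μ :=
  (EReal.coe_lt_coe_iff.2 h).trans_le (le_sSup ⟨θ, hθ, rfl⟩)

lemma phiB_le_of_forall_le {x : ℝ} (h : ∀ θ ∈ interior (Theta μ), θ ≤ x) : phiB μ ≤ x :=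
  sSup_le fun _ ⟨θ, hθ, he⟩ => he ▸ EReal.coe_le_coe_iff.2 (h θ hθ)

lemma IsSteep.phi_eq (h : IsSteep μ) (hθ : θ ∈ interior (Theta μ)) {z : ℝ}
    (hz : psi' μ θ = z) : phi μ z = θ := by
  rw [← hz, h.phi_psi' hθ]

lemma ne_zero_of_psi'_ne_zero (h : psi' μ θ ≠ 0) : μ ≠ 0 := by
  rintro rfl
  refine h ?_
  have : psi (0 : Measure ℝ) = fun _ => 0 := by
    ext x
    simp [psi, cgf]
  simp [psi', this]

/-- A measure on `[0, ∞)` whose tilted means exhaust `(0, ∞)`. -/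
lemma isSteep_of_nonneg (hne : (Theta μ).Nontrivial) (h0 : ∀ᵐ x : ℝ ∂μ, 0 ≤ x)
    (hs : ∀ z : ℝ, 0 < z → ∃ θ ∈ interior (Theta μ), psi' μ θ = z) :
    IsSteep μ ∧ 0 ≤ suppInf μ ∧ ∀ z, 0 < z → z ∈ meanRange μ := by
  obtain ⟨θ₁, hθ₁, hz₁⟩ := hs 1 one_pos
  have hμ : μ ≠ 0 := ne_zero_of_psi'_ne_zero (θ := θ₁) (by rw [hz₁]; exact one_ne_zero)
  have hinf : ∀ z : ℝ, 0 < z → suppInf μ < z := fun z hz => by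
    obtain ⟨θ, hθ, hθz⟩ := hs (z / 2) (by linarith)
    refine (suppInf_le_psi' hμ hθ).trans_lt ?_
    rw [hθz, EReal.coe_lt_coe_iff]
    linarith
  have hsup : ∀ z : ℝ, 0 < z → (z : EReal) < suppSup μ := fun z hz => by
    obtain ⟨θ, hθ, hθz⟩ := hs (z + 1) (by linarith)
    refine lt_of_lt_of_le ?_ (psi'_le_suppSup hμ hθ)
    rw [hθz, EReal.coe_lt_coe_iff]
    linarith
  have hnn : 0 ≤ suppInf μ := by
    refine le_sInf fun _ ⟨x, hx, he⟩ => ?_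
    have : x ∈ Set.Ici (0 : ℝ) := Measure.support_subset_of_isClosed isClosed_Ici h0 hx
    rw [← he]
    exact EReal.coe_nonneg.2 this
  refine ⟨⟨hne, (hinf 1 one_pos).trans (hsup 1 one_pos), fun z hz => ?_⟩, hnn,
    fun z hz => ⟨hinf z hz, hsup z hz⟩⟩
  exact hs z (EReal.coe_pos.1 (hnn.trans_lt hz.1))

lemma concaveOn_log_comp {I : Set ℝ} {k : ℝ → ℝ} (hk : ConcaveOn ℝ I k)
    (hpos : ∀ x ∈ I, 0 < k x) : ConcaveOn ℝ I (fun x => Real.log (k x)) := by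
  refine ⟨hk.1, fun x hx y hy a b ha hb hab => ?_⟩
  refine (strictConcaveOn_log_Ioi.concaveOn.2 (hpos x hx) (hpos y hy) ha hb hab).trans ?_
  exact Real.log_le_log ((convex_Ioi (0 : ℝ)) (hpos x hx) (hpos y hy) ha hb hab)
    (hk.2 hx hy ha hb hab)

/-- The moment generating function with values in `[0, ∞]`. -/
noncomputable def laplace (μ : Measure ℝ) (θ : ℝ) : ENNReal :=
  ∫⁻ x, ENNReal.ofReal (Real.exp (θ * x)) ∂μ

lemma mem_Theta_iff_laplace : θ ∈ Theta μ ↔ laplace μ θ < ⊤ := by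
  change Integrable (fun x => Real.exp (θ * x)) μ ↔ _
  rw [laplace, ← hasFiniteIntegral_iff_ofReal (ae_of_all _ fun x => (Real.exp_pos _).le)]
  exact ⟨fun h => h.2, fun h => ⟨by fun_prop, h⟩⟩

lemma psi_eq_log_laplace (μ : Measure ℝ) (θ : ℝ) : psi μ θ = Real.log (laplace μ θ).toReal := by
  change Real.log (∫ x, Real.exp (θ * x) ∂μ) = _
  rw [integral_eq_lintegral_of_nonneg_ae (ae_of_all _ fun x => (Real.exp_pos _).le) (by fun_prop),
    laplace]

end Explicit

section NegBin

lemma laplace_countingNat (θ : ℝ) :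
    laplace countingNat θ = (1 - ENNReal.ofReal (Real.exp θ))⁻¹ := by
  rw [laplace, countingNat, lintegral_sum_measure, ← ENNReal.tsum_geometric]
  refine tsum_congr fun k => ?_
  rw [lintegral_dirac, ← ENNReal.ofReal_pow (Real.exp_pos _).le, ← Real.exp_nat_mul, mul_comm]

instance : SFinite countingNat := by
  unfold countingNat
  infer_instance

instance (r : ℕ) : SFinite (negBinBase r) := by
  induction r with
  | zero => exact inferInstanceAs (SFinite (Measure.dirac (0 : ℝ)))
  | succ r ih => exact inferInstanceAs (SFinite (Measure.conv countingNat (negBinBase r)))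

lemma laplace_negBinBase (r : ℕ) (θ : ℝ) :
    laplace (negBinBase r) θ = ((1 - ENNReal.ofReal (Real.exp θ))⁻¹) ^ r := by
  induction r with
  | zero => simp [negBinBase, laplace]
  | succ r ih =>
    rw [laplace, negBinBase, Measure.lintegral_conv (by fun_prop), pow_succ', ← ih,
      ← laplace_countingNat, laplace, laplace, ← lintegral_mul_const _ (by fun_prop)]
    refine lintegral_congr fun x => ?_
    rw [← lintegral_const_mul _ (by fun_prop)]
    refine lintegral_congr fun y => ?_
    rw [← ENNReal.ofReal_mul (Real.exp_pos _).le, ← Real.exp_add, mul_add]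

lemma ae_nonneg_countingNat : ∀ᵐ x : ℝ ∂countingNat, 0 ≤ x := by
  rw [countingNat, Measure.ae_sum_iff' measurableSet_Ici]
  intro k
  rw [ae_dirac_iff measurableSet_Ici]
  positivity

lemma ae_nonneg_negBinBase (r : ℕ) : ∀ᵐ x : ℝ ∂(negBinBase r), 0 ≤ x := by
  induction r with
  | zero => exact (ae_dirac_iff measurableSet_Ici).2 le_rfl
  | succ r ih =>
    rw [negBinBase, Measure.conv, ae_map_iff (by fun_prop) measurableSet_Ici]
    filter_upwards [Measure.quasiMeasurePreserving_fst.ae ae_nonneg_countingNat,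
      Measure.quasiMeasurePreserving_snd.ae ih] with p h1 h2
    exact add_nonneg h1 h2

lemma Theta_negBinBase {r : ℕ} (hr : 1 ≤ r) : Theta (negBinBase r) = Set.Iio 0 := by
  ext θ
  rw [mem_Theta_iff_laplace, laplace_negBinBase, ENNReal.pow_lt_top_iff, ENNReal.inv_lt_top,
    tsub_pos_iff_lt, ENNReal.ofReal_lt_one, Real.exp_lt_one_iff]
  simp [Nat.one_le_iff_ne_zero.1 hr]

lemma one_sub_exp_pos {θ : ℝ} (hθ : θ < 0) : 0 < 1 - Real.exp θ :=
  sub_pos.2 (Real.exp_lt_one_iff.2 hθ)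

lemma psi_negBinBase (r : ℕ) {θ : ℝ} (hθ : θ < 0) :
    psi (negBinBase r) θ = -r * Real.log (1 - Real.exp θ) := by
  have h1 := one_sub_exp_pos hθ
  rw [psi_eq_log_laplace, laplace_negBinBase, ENNReal.toReal_pow, ENNReal.toReal_inv,
    ← ENNReal.ofReal_one, ← ENNReal.ofReal_sub _ (Real.exp_pos _).le,
    ENNReal.toReal_ofReal h1.le, Real.log_pow, Real.log_inv]
  ring

variable {r : ℕ}

lemma interior_Theta_negBinBase (hr : 1 ≤ r) : interior (Theta (negBinBase r)) = Set.Iio 0 := by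
  rw [Theta_negBinBase hr, interior_Iio]

lemma hasDerivAt_one_sub_exp (θ : ℝ) : HasDerivAt (fun θ => 1 - Real.exp θ) (-Real.exp θ) θ :=
  (Real.hasDerivAt_exp θ).const_sub 1

lemma psi'_negBinBase (hr : 1 ≤ r) {θ : ℝ} (hθ : θ < 0) :
    psi' (negBinBase r) θ = r * Real.exp θ / (1 - Real.exp θ) := by
  have h1 := one_sub_exp_pos hθ
  refine psi'_eq_of_hasDerivAt (g := fun θ => -r * Real.log (1 - Real.exp θ)) (fun η hη => ?_)
    (by rwa [interior_Theta_negBinBase hr]) ?_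
  · rw [interior_Theta_negBinBase hr] at hη
    exact psi_negBinBase r hη
  · exact (((hasDerivAt_one_sub_exp θ).log h1.ne').const_mul (-r : ℝ)).congr_deriv (by ring)

lemma psi''_negBinBase (hr : 1 ≤ r) {θ : ℝ} (hθ : θ < 0) :
    psi'' (negBinBase r) θ = r * Real.exp θ / (1 - Real.exp θ) ^ 2 := by
  have h1 := one_sub_exp_pos hθ
  refine psi''_eq_of_hasDerivAt (g := fun θ => r * Real.exp θ / (1 - Real.exp θ)) (fun η hη => ?_)
    (by rwa [interior_Theta_negBinBase hr]) ?_
  · rw [interior_Theta_negBinBase hr] at hη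
    exact psi'_negBinBase hr hη
  · exact (((Real.hasDerivAt_exp θ).const_mul (r : ℝ)).fun_div (hasDerivAt_one_sub_exp θ)
      h1.ne').congr_deriv (by ring)

lemma logConvex_negBinBase (hr : 1 ≤ r) : ConvexOn ℝ (interior (Theta (negBinBase r)))
    (fun θ => Real.log (psi'' (negBinBase r) θ)) := by
  rw [interior_Theta_negBinBase hr]
  have hconc : ConcaveOn ℝ (Set.Iio (0 : ℝ)) (fun θ => Real.log (1 - Real.exp θ)) :=
    concaveOn_log_comp ((concaveOn_const 1 (convex_Iio 0)).sub
      (convexOn_exp.subset (Set.subset_univ _) (convex_Iio 0))) fun x hx => one_sub_exp_pos hx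
  have hlin : ConvexOn ℝ (Set.Iio (0 : ℝ)) (fun θ => Real.log r + θ) :=
    (convexOn_const (Real.log r) (convex_Iio 0)).add (convexOn_id (convex_Iio 0))
  refine (hlin.add ((hconc.neg).smul zero_le_two)).congr fun θ hθ => ?_
  have h1 := one_sub_exp_pos hθ
  have hr' : (r : ℝ) ≠ 0 := by exact_mod_cast (Nat.one_le_iff_ne_zero.1 hr)
  rw [psi''_negBinBase hr hθ, Real.log_div (by positivity) (by positivity),
    Real.log_mul hr' (Real.exp_pos θ).ne', Real.log_exp, Real.log_pow]
  simp
  ring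

lemma log_div_add_neg (hr : 1 ≤ r) {z : ℝ} (hz : 0 < z) : Real.log (z / (z + r)) < 0 := by
  have hr' : (1 : ℝ) ≤ r := by exact_mod_cast hr
  refine Real.log_neg (by positivity) ?_
  rw [div_lt_one (by positivity)]
  linarith

lemma psi'_negBinBase_log (hr : 1 ≤ r) {z : ℝ} (hz : 0 < z) :
    psi' (negBinBase r) (Real.log (z / (z + r))) = z := by
  have hr' : (1 : ℝ) ≤ r := by exact_mod_cast hr
  rw [psi'_negBinBase hr (log_div_add_neg hr hz), Real.exp_log (by positivity)]
  have h2 : 1 - z / (z + r) = r / (z + r) := by field_simp; ring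
  rw [h2]
  field_simp

lemma isSteep_negBinBase (hr : 1 ≤ r) : IsSteep (negBinBase r) ∧ 0 ≤ suppInf (negBinBase r) ∧
    ∀ z, 0 < z → z ∈ meanRange (negBinBase r) := by
  refine isSteep_of_nonneg ?_ (ae_nonneg_negBinBase r) fun z hz =>
    ⟨Real.log (z / (z + r)), ?_, psi'_negBinBase_log hr hz⟩
  · rw [Theta_negBinBase hr]
    exact ⟨-1, by simp, -2, by simp, by norm_num⟩
  · rw [interior_Theta_negBinBase hr]
    exact log_div_add_neg hr hz

lemma phi_negBinBase (hr : 1 ≤ r) {z : ℝ} (hz : 0 < z) :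
    phi (negBinBase r) z = Real.log (z / (z + r)) :=
  (isSteep_negBinBase hr).1.phi_eq
    (by rw [interior_Theta_negBinBase hr]; exact log_div_add_neg hr hz) (psi'_negBinBase_log hr hz)

lemma two_mul_phi_negBinBase (hr : 1 ≤ r) {s t : ℝ} (hs : 0 < s) (ht : 0 < t) :
    2 * phi (negBinBase r) t - phi (negBinBase r) s =
      Real.log (t ^ 2 * (s + r) / ((t + r) ^ 2 * s)) := by
  have hr' : (0 : ℝ) < r := by exact_mod_cast hr
  rw [phi_negBinBase hr hs, phi_negBinBase hr ht, Real.log_div, Real.log_div, Real.log_div,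
    Real.log_mul, Real.log_mul, Real.log_pow, Real.log_pow]
  · push_cast; ring
  all_goals positivity

lemma two_mul_phi_negBinBase_neg (hr : 1 ≤ r) {s t : ℝ} (hs : 0 < s) (hst : s < t)
    (h : t / s < 1 + √(1 + r / s)) : 2 * phi (negBinBase r) t - phi (negBinBase r) s < 0 := by
  have ht : 0 < t := hs.trans hst
  have hr' : (0 : ℝ) < r := by exact_mod_cast hr
  have h1 : t / s - 1 < √(1 + r / s) := by linarith
  have h2 : 1 < t / s := (one_lt_div hs).2 hst
  rw [Real.lt_sqrt (by linarith)] at h1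
  have h3 : (t - s) ^ 2 < s ^ 2 + r * s := by
    have := mul_lt_mul_of_pos_right h1 (pow_pos hs 2)
    have e1 : (t / s - 1) ^ 2 * s ^ 2 = (t - s) ^ 2 := by field_simp
    have e2 : (1 + r / s) * s ^ 2 = s ^ 2 + r * s := by field_simp
    rwa [e1, e2] at this
  rw [two_mul_phi_negBinBase hr hs ht]
  refine Real.log_neg (by positivity) ?_
  rw [div_lt_one (by positivity)]
  nlinarith [mul_lt_mul_of_pos_left h3 hr']

lemma two_mul_phi_negBinBase_pos (hr : 1 ≤ r) {s t : ℝ} (hs : 0 < s) (hst : s < t)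
    (h : 1 + √(1 + r / s) < t / s) : 0 < 2 * phi (negBinBase r) t - phi (negBinBase r) s := by
  have ht : 0 < t := hs.trans hst
  have hr' : (0 : ℝ) < r := by exact_mod_cast hr
  have h1 : √(1 + r / s) < t / s - 1 := by linarith
  have h2 : 1 < t / s := (one_lt_div hs).2 hst
  rw [Real.sqrt_lt' (by linarith)] at h1
  have h3 : s ^ 2 + r * s < (t - s) ^ 2 := by
    have := mul_lt_mul_of_pos_right h1 (pow_pos hs 2)
    have e1 : (t / s - 1) ^ 2 * s ^ 2 = (t - s) ^ 2 := by field_simp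
    have e2 : (1 + r / s) * s ^ 2 = s ^ 2 + r * s := by field_simp
    rwa [e1, e2] at this
  rw [two_mul_phi_negBinBase hr hs ht]
  refine Real.log_pos ?_
  rw [one_lt_div (by positivity)]
  nlinarith [mul_lt_mul_of_pos_left h3 hr']

theorem negBinBase_mem_Omega (hr : 1 ≤ r) {s t : ℝ} (hs : 0 < s) (hst : s < t)
    (h : t / s < 1 + √(1 + r / s)) : (s, t) ∈ Omega (negBinBase r) := by
  obtain ⟨hS, -, hm⟩ := isSteep_negBinBase hr
  have hneg := two_mul_phi_negBinBase_neg hr hs hst h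
  have hI := interior_Theta_negBinBase hr
  refine hS.mem_Omega (logConvex_negBinBase hr) (hm s hs) (hm t (hs.trans hst)) hst.le
    (phiA_lt_of_mem (θ := min (3 * phi (negBinBase r) s - 2 * phi (negBinBase r) t) 0 - 1) ?_ ?_)
    (lt_phiB_of_mem (θ := (2 * phi (negBinBase r) t - phi (negBinBase r) s) / 2) ?_ ?_)
  · rw [hI, Set.mem_Iio]
    linarith [min_le_right (3 * phi (negBinBase r) s - 2 * phi (negBinBase r) t) 0]
  · linarith [min_le_left (3 * phi (negBinBase r) s - 2 * phi (negBinBase r) t) 0]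
  · rw [hI, Set.mem_Iio]
    linarith
  · linarith

theorem negBinBase_blowUp (hr : 1 ≤ r) {s t : ℝ} (hs : 0 < s) (hst : s < t)
    (h : 1 + √(1 + r / s) < t / s) : TypicalTablesBlowUp (negBinBase r) s t := by
  obtain ⟨hS, h0, hm⟩ := isSteep_negBinBase hr
  refine hS.typicalTablesBlowUp h0 (hm s hs) (hm t (hs.trans hst)) hst.le
    ((phiB_le_of_forall_le (x := 0) fun θ hθ => ?_).trans_lt
      (EReal.coe_lt_coe_iff.2 (two_mul_phi_negBinBase_pos hr hs hst h)))
  rw [interior_Theta_negBinBase hr] at hθ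
  exact le_of_lt hθ

end NegBin

section Gamma

variable {a γ : ℝ}

lemma laplace_gammaBase (a γ θ : ℝ) : laplace (gammaBase a γ) θ =
    ∫⁻ x in Set.Ioi (0 : ℝ), ENNReal.ofReal (x ^ (γ - 1) * Real.exp (-((a - θ) * x))) := by
  rw [laplace, gammaBase, lintegral_withDensity_eq_lintegral_mul _ (by fun_prop) (by fun_prop)]
  refine setLIntegral_congr_fun measurableSet_Ioi fun x (hx : 0 < x) => ?_
  rw [Pi.mul_apply, ← ENNReal.ofReal_mul (by positivity)]
  congr 1
  rw [show -((a - θ) * x) = -a * x + θ * x by ring, Real.exp_add]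
  ring

lemma integrableOn_rpow_mul_exp_neg (hγ : 0 < γ) {b : ℝ} (hb : 0 < b) :
    IntegrableOn (fun x : ℝ => x ^ (γ - 1) * Real.exp (-(b * x))) (Set.Ioi 0) := by
  refine Integrable.of_integral_ne_zero ?_
  rw [Real.integral_rpow_mul_exp_neg_mul_Ioi hγ hb]
  have := Real.Gamma_pos_of_pos hγ
  positivity

lemma laplace_gammaBase_of_lt (hγ : 0 < γ) {θ : ℝ} (hθ : θ < a) : laplace (gammaBase a γ) θ =
    ENNReal.ofReal ((1 / (a - θ)) ^ γ * Real.Gamma γ) := by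
  have hb : 0 < a - θ := sub_pos.2 hθ
  rw [laplace_gammaBase, ← ofReal_integral_eq_lintegral_ofReal (integrableOn_rpow_mul_exp_neg hγ hb),
    Real.integral_rpow_mul_exp_neg_mul_Ioi hγ hb]
  filter_upwards [ae_restrict_mem measurableSet_Ioi] with x hx
  have : 0 < x := hx
  positivity

lemma Theta_gammaBase (hγ : 0 < γ) : Theta (gammaBase a γ) = Set.Iio a := by
  ext θ
  rw [mem_Theta_iff_laplace, Set.mem_Iio]
  refine ⟨fun h => ?_, fun h => ?_⟩
  · by_contra! hle
    rw [laplace_gammaBase] at h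
    refine not_integrableOn_Ioi_rpow (γ - 1) ⟨by fun_prop, ?_⟩
    rw [hasFiniteIntegral_iff_ofReal]
    · refine lt_of_le_of_lt (setLIntegral_mono' measurableSet_Ioi fun x (hx : 0 < x) => ?_) h
      refine ENNReal.ofReal_le_ofReal (le_mul_of_one_le_right (by positivity) ?_)
      exact Real.one_le_exp (by nlinarith)
    · filter_upwards [ae_restrict_mem measurableSet_Ioi] with x hx
      have : 0 < x := hx
      exact Real.rpow_nonneg this.le _
  · rw [laplace_gammaBase_of_lt hγ h]
    exact ENNReal.ofReal_lt_top

lemma interior_Theta_gammaBase (hγ : 0 < γ) : interior (Theta (gammaBase a γ)) = Set.Iio a := by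
  rw [Theta_gammaBase hγ, interior_Iio]

lemma psi_gammaBase (hγ : 0 < γ) {θ : ℝ} (hθ : θ < a) :
    psi (gammaBase a γ) θ = -γ * Real.log (a - θ) + Real.log (Real.Gamma γ) := by
  have hb : 0 < a - θ := sub_pos.2 hθ
  have hG := Real.Gamma_pos_of_pos hγ
  rw [psi_eq_log_laplace, laplace_gammaBase_of_lt hγ hθ, ENNReal.toReal_ofReal (by positivity),
    Real.log_mul (by positivity) hG.ne', Real.log_rpow (by positivity), one_div, Real.log_inv]
  ring

lemma psi'_gammaBase (hγ : 0 < γ) {θ : ℝ} (hθ : θ < a) :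
    psi' (gammaBase a γ) θ = γ / (a - θ) := by
  refine psi'_eq_of_hasDerivAt (g := fun θ => -γ * Real.log (a - θ) + Real.log (Real.Gamma γ))
    (fun η hη => ?_) (by rwa [interior_Theta_gammaBase hγ]) ?_
  · rw [interior_Theta_gammaBase hγ] at hη
    exact psi_gammaBase hγ hη
  · exact (((((hasDerivAt_id θ).const_sub a).log (sub_pos.2 hθ).ne').const_mul (-γ)).add_const
      (Real.log (Real.Gamma γ))).congr_deriv (by simp; ring)

lemma psi''_gammaBase (hγ : 0 < γ) {θ : ℝ} (hθ : θ < a) :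
    psi'' (gammaBase a γ) θ = γ / (a - θ) ^ 2 := by
  refine psi''_eq_of_hasDerivAt (g := fun θ => γ / (a - θ))
    (fun η hη => ?_) (by rwa [interior_Theta_gammaBase hγ]) ?_
  · rw [interior_Theta_gammaBase hγ] at hη
    exact psi'_gammaBase hγ hη
  · exact ((hasDerivAt_const θ γ).fun_div ((hasDerivAt_id θ).const_sub a)
      (sub_pos.2 hθ).ne').congr_deriv (by simp)

lemma logConvex_gammaBase (hγ : 0 < γ) : ConvexOn ℝ (interior (Theta (gammaBase a γ)))
    (fun θ => Real.log (psi'' (gammaBase a γ) θ)) := by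
  rw [interior_Theta_gammaBase hγ]
  have hconc : ConcaveOn ℝ (Set.Iio a) (fun θ => Real.log (a - θ)) :=
    concaveOn_log_comp ((concaveOn_const a (convex_Iio a)).sub (convexOn_id (convex_Iio a)))
      fun x hx => sub_pos.2 hx
  refine ((convexOn_const (Real.log γ) (convex_Iio a)).add
    ((hconc.neg).smul zero_le_two)).congr fun θ hθ => ?_
  have h1 : 0 < a - θ := sub_pos.2 hθ
  rw [psi''_gammaBase hγ hθ, Real.log_div hγ.ne' (by positivity), Real.log_pow]
  simp
  ring

lemma ae_nonneg_gammaBase : ∀ᵐ x : ℝ ∂(gammaBase a γ), 0 ≤ x := by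
  refine (withDensity_absolutelyContinuous _ _).ae_le ?_
  filter_upwards [ae_restrict_mem measurableSet_Ioi] with x hx using le_of_lt hx

lemma psi'_gammaBase_sub_div (hγ : 0 < γ) {z : ℝ} (hz : 0 < z) :
    psi' (gammaBase a γ) (a - γ / z) = z := by
  have : 0 < γ / z := by positivity
  rw [psi'_gammaBase hγ (by linarith)]
  field_simp
  simp [hγ.ne']

lemma sub_div_mem_interior_Theta (hγ : 0 < γ) {z : ℝ} (hz : 0 < z) :
    a - γ / z ∈ interior (Theta (gammaBase a γ)) := by
  have : 0 < γ / z := by positivity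
  rw [interior_Theta_gammaBase hγ, Set.mem_Iio]
  linarith

lemma isSteep_gammaBase (hγ : 0 < γ) : IsSteep (gammaBase a γ) ∧ 0 ≤ suppInf (gammaBase a γ) ∧
    ∀ z, 0 < z → z ∈ meanRange (gammaBase a γ) := by
  refine isSteep_of_nonneg ?_ ae_nonneg_gammaBase fun z hz =>
    ⟨a - γ / z, sub_div_mem_interior_Theta hγ hz, psi'_gammaBase_sub_div hγ hz⟩
  rw [Theta_gammaBase hγ]
  exact ⟨a - 1, by simp, a - 2, by simp, by norm_num⟩

lemma two_mul_phi_gammaBase (hγ : 0 < γ) {s t : ℝ} (hs : 0 < s) (ht : 0 < t) :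
    2 * phi (gammaBase a γ) t - phi (gammaBase a γ) s = a + γ * (t / s - 2) / t := by
  have hS := (isSteep_gammaBase (a := a) hγ).1
  rw [hS.phi_eq (sub_div_mem_interior_Theta hγ hs) (psi'_gammaBase_sub_div hγ hs),
    hS.phi_eq (sub_div_mem_interior_Theta hγ ht) (psi'_gammaBase_sub_div hγ ht)]
  field_simp
  ring

theorem gammaBase_mem_Omega (hγ : 0 < γ) {s t : ℝ} (hs : 0 < s) (hst : s < t)
    (h : t / s < 2) : (s, t) ∈ Omega (gammaBase a γ) := by
  obtain ⟨hS, -, hm⟩ := isSteep_gammaBase (a := a) hγ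
  have ht := hs.trans hst
  have hneg : 2 * phi (gammaBase a γ) t - phi (gammaBase a γ) s < a := by
    rw [two_mul_phi_gammaBase hγ hs ht]
    have := div_neg_of_neg_of_pos (mul_neg_of_pos_of_neg hγ (sub_neg.2 h)) ht
    linarith
  have hI := interior_Theta_gammaBase (a := a) hγ
  refine hS.mem_Omega (logConvex_gammaBase hγ) (hm s hs) (hm t ht) hst.le
    (phiA_lt_of_mem (θ := min (3 * phi (gammaBase a γ) s - 2 * phi (gammaBase a γ) t) a - 1) ?_ ?_)
    (lt_phiB_of_mem (θ := (2 * phi (gammaBase a γ) t - phi (gammaBase a γ) s + a) / 2) ?_ ?_)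
  · rw [hI, Set.mem_Iio]
    linarith [min_le_right (3 * phi (gammaBase a γ) s - 2 * phi (gammaBase a γ) t) a]
  · linarith [min_le_left (3 * phi (gammaBase a γ) s - 2 * phi (gammaBase a γ) t) a]
  · rw [hI, Set.mem_Iio]
    linarith
  · linarith

theorem gammaBase_blowUp (hγ : 0 < γ) {s t : ℝ} (hs : 0 < s) (hst : s < t)
    (h : 2 < t / s) : TypicalTablesBlowUp (gammaBase a γ) s t := by
  obtain ⟨hS, h0, hm⟩ := isSteep_gammaBase (a := a) hγ
  have ht := hs.trans hst
  refine hS.typicalTablesBlowUp h0 (hm s hs) (hm t ht) hst.le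
    ((phiB_le_of_forall_le (x := a) fun θ hθ => ?_).trans_lt (EReal.coe_lt_coe_iff.2 ?_))
  · rw [interior_Theta_gammaBase hγ] at hθ
    exact le_of_lt hθ
  · rw [two_mul_phi_gammaBase hγ hs ht]
    have := div_pos (mul_pos hγ (sub_pos.2 h)) ht
    linarith

end Gamma

/-- If `Θ` is the whole line, log-convexity of `ψ''` is enough for tameness. -/
lemma IsSteep.mem_Omega_of_Theta_eq_univ {μ : Measure ℝ} (h : IsSteep μ)
    (hT : Theta μ = Set.univ) (hlog : ConvexOn ℝ Set.univ (fun θ => Real.log (psi'' μ θ)))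
    {s t : ℝ} (hs : s ∈ meanRange μ) (ht : t ∈ meanRange μ) (hst : s ≤ t) : (s, t) ∈ Omega μ := by
  have hI : interior (Theta μ) = Set.univ := by rw [hT, interior_univ]
  refine h.mem_Omega (by rwa [hI]) hs ht hst
    (phiA_lt_of_mem (by rw [hI]; trivial) (sub_one_lt _))
    (lt_phiB_of_mem (by rw [hI]; trivial) (lt_add_one _))

section Poisson

variable {κ ρ : ℝ}

lemma laplace_poissonBase (hκ : 0 < κ) (hρ : 0 < ρ) (θ : ℝ) :
    laplace (poissonBase κ ρ) θ = ENNReal.ofReal (κ * Real.exp (ρ * Real.exp θ)) := by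
  have hsum : HasSum (fun k : ℕ => κ * ((ρ * Real.exp θ) ^ k / (k.factorial : ℝ)))
      (κ * Real.exp (ρ * Real.exp θ)) := by
    rw [Real.exp_eq_exp_ℝ]
    exact (NormedSpace.expSeries_div_hasSum_exp (ρ * NormedSpace.exp θ)).mul_left κ
  rw [← hsum.tsum_eq, ENNReal.ofReal_tsum_of_nonneg (fun k => by positivity) hsum.summable,
    laplace, poissonBase, lintegral_sum_measure]
  refine tsum_congr fun k => ?_
  rw [lintegral_smul_measure, lintegral_dirac, smul_eq_mul, ← ENNReal.ofReal_mul (by positivity)]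
  congr 1
  rw [mul_pow, ← Real.exp_nat_mul, mul_comm θ]
  ring

lemma Theta_poissonBase (hκ : 0 < κ) (hρ : 0 < ρ) : Theta (poissonBase κ ρ) = Set.univ := by
  ext θ
  rw [mem_Theta_iff_laplace, laplace_poissonBase hκ hρ]
  simp

lemma psi_poissonBase (hκ : 0 < κ) (hρ : 0 < ρ) (θ : ℝ) :
    psi (poissonBase κ ρ) θ = Real.log κ + ρ * Real.exp θ := by
  rw [psi_eq_log_laplace, laplace_poissonBase hκ hρ, ENNReal.toReal_ofReal (by positivity),
    Real.log_mul hκ.ne' (Real.exp_pos _).ne', Real.log_exp]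

lemma psi'_poissonBase (hκ : 0 < κ) (hρ : 0 < ρ) (θ : ℝ) :
    psi' (poissonBase κ ρ) θ = ρ * Real.exp θ :=
  psi'_eq_of_hasDerivAt (fun η _ => psi_poissonBase hκ hρ η)
    (by rw [Theta_poissonBase hκ hρ, interior_univ]; trivial)
    (((Real.hasDerivAt_exp θ).const_mul ρ).const_add (Real.log κ))

lemma psi''_poissonBase (hκ : 0 < κ) (hρ : 0 < ρ) (θ : ℝ) :
    psi'' (poissonBase κ ρ) θ = ρ * Real.exp θ :=
  psi''_eq_of_hasDerivAt (fun η _ => psi'_poissonBase hκ hρ η)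
    (by rw [Theta_poissonBase hκ hρ, interior_univ]; trivial)
    ((Real.hasDerivAt_exp θ).const_mul ρ)

lemma ae_nonneg_poissonBase : ∀ᵐ x : ℝ ∂(poissonBase κ ρ), 0 ≤ x := by
  rw [poissonBase, Measure.ae_sum_iff' measurableSet_Ici]
  intro k
  refine Measure.ae_smul_measure ?_ _
  rw [ae_dirac_iff measurableSet_Ici]
  positivity

theorem poissonBase_mem_Omega (hκ : 0 < κ) (hρ : 0 < ρ) {s t : ℝ} (hs : 0 < s) (hst : s < t) :
    (s, t) ∈ Omega (poissonBase κ ρ) := by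
  have hT := Theta_poissonBase hκ hρ
  obtain ⟨hS, -, hm⟩ := isSteep_of_nonneg (μ := poissonBase κ ρ)
    (by rw [hT]; exact Set.nontrivial_univ) ae_nonneg_poissonBase fun z hz =>
      ⟨Real.log (z / ρ), by rw [hT, interior_univ]; trivial, by
        rw [psi'_poissonBase hκ hρ, Real.exp_log (by positivity)]
        field_simp⟩
  refine hS.mem_Omega_of_Theta_eq_univ hT ?_ (hm s hs) (hm t (hs.trans hst)) hst.le
  refine ((convexOn_const (Real.log ρ) convex_univ).add (convexOn_id convex_univ)).congr
    fun θ _ => ?_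
  rw [psi''_poissonBase hκ hρ, Real.log_mul hρ.ne' (Real.exp_pos _).ne', Real.log_exp]
  rfl

end Poisson

section Gaussian

variable {x : ℝ} {v : NNReal}

lemma psi_gaussianReal (x : ℝ) (v : NNReal) (θ : ℝ) :
    psi (gaussianReal x v) θ = x * θ + v * θ ^ 2 / 2 :=
  cgf_gaussianReal Measure.map_id θ

lemma Theta_gaussianReal (x : ℝ) (v : NNReal) : Theta (gaussianReal x v) = Set.univ :=
  integrableExpSet_id_gaussianReal

lemma psi'_gaussianReal (x : ℝ) (v : NNReal) (θ : ℝ) :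
    psi' (gaussianReal x v) θ = x + v * θ :=
  psi'_eq_of_hasDerivAt (fun η _ => psi_gaussianReal x v η)
    (by rw [Theta_gaussianReal, interior_univ]; trivial)
    ((((hasDerivAt_id θ).const_mul x).add
      ((((hasDerivAt_id θ).pow 2).const_mul (v : ℝ)).div_const 2)).congr_deriv (by simp; ring))

lemma psi''_gaussianReal (x : ℝ) (v : NNReal) (θ : ℝ) : psi'' (gaussianReal x v) θ = v :=
  psi''_eq_of_hasDerivAt (fun η _ => psi'_gaussianReal x v η)
    (by rw [Theta_gaussianReal, interior_univ]; trivial)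
    ((((hasDerivAt_id θ).const_mul (v : ℝ)).const_add x).congr_deriv (by simp))

theorem gaussianReal_mem_Omega (hv : v ≠ 0) {s t : ℝ} (hst : s < t) :
    (s, t) ∈ Omega (gaussianReal x v) := by
  have hv' : (v : ℝ) ≠ 0 := by exact_mod_cast hv
  have hT := Theta_gaussianReal x v
  have hμ : gaussianReal x v ≠ 0 := IsProbabilityMeasure.ne_zero _
  have hI : ∀ θ, θ ∈ interior (Theta (gaussianReal x v)) := fun θ => by
    rw [hT, interior_univ]; trivial
  have hsurj : ∀ z, psi' (gaussianReal x v) ((z - x) / v) = z := fun z => by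
    rw [psi'_gaussianReal]
    field_simp
    ring
  have hm : ∀ z, z ∈ meanRange (gaussianReal x v) := fun z => by
    refine ⟨lt_of_le_of_lt (suppInf_le_psi' hμ (hI ((z - 1 - x) / v))) ?_,
      lt_of_lt_of_le ?_ (psi'_le_suppSup hμ (hI ((z + 1 - x) / v)))⟩ <;>
      rw [hsurj, EReal.coe_lt_coe_iff] <;> linarith
  have hS : IsSteep (gaussianReal x v) :=
    ⟨by rw [hT]; exact Set.nontrivial_univ, (hm 0).1.trans (hm 0).2,
      fun z _ => ⟨_, hI _, hsurj z⟩⟩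
  refine hS.mem_Omega_of_Theta_eq_univ hT ?_ (hm s) (hm t) hst.le
  exact (convexOn_const (Real.log v) convex_univ).congr fun θ _ => by rw [psi''_gaussianReal]

end Gaussian

end TameMargins

theorem mainTheorem7 :
    (∀ (μ : Measure ℝ) [SigmaFinite μ],
      (Theta μ).Nontrivial →
      suppInf μ < suppSup μ →
      Set.SurjOn (psi' μ) (interior (Theta μ)) (meanRange μ) →
        (MonotoneOn (psi'' μ) (interior (Theta μ)) →
          ConvexOn ℝ (interior (Theta μ)) (fun θ => Real.log (psi'' μ θ)) →
            suppSup μ = ⊤ ∧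
            ∀ s t : ℝ, s ∈ meanRange μ → t ∈ meanRange μ → s ≤ t →
              phiA μ < ((3 * phi μ s - 2 * phi μ t : ℝ) : EReal) →
              ((2 * phi μ t - phi μ s : ℝ) : EReal) < phiB μ →
              (s, t) ∈ Omega μ) ∧
        (phiA μ = ⊥ →
          ∀ s t : ℝ, s ∈ meanRange μ → t ∈ meanRange μ → s ≤ t →
            phiB μ < ((2 * phi μ t - phi μ s : ℝ) : EReal) →
            (s, t) ∉ Omega μ)) ∧
    (∀ r : ℕ, 1 ≤ r → ∀ s t : ℝ, 0 < s → s < t →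
      (t / s < 1 + Real.sqrt (1 + r / s) → (s, t) ∈ Omega (negBinBase r)) ∧
      (1 + Real.sqrt (1 + r / s) < t / s → TypicalTablesBlowUp (negBinBase r) s t)) ∧
    (∀ a γ : ℝ, 0 ≤ a → 0 < γ → ∀ s t : ℝ, 0 < s → s < t →
      (t / s < 2 → (s, t) ∈ Omega (gammaBase a γ)) ∧
      (2 < t / s → TypicalTablesBlowUp (gammaBase a γ) s t)) ∧
    (∀ κ ρ : ℝ, 0 < κ → 0 < ρ → ∀ s t : ℝ, 0 < s → s < t →
      (s, t) ∈ Omega (poissonBase κ ρ)) ∧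
    (∀ (x : ℝ) (v : NNReal), v ≠ 0 → ∀ s t : ℝ, 0 < s → s < t →
      (s, t) ∈ Omega (gaussianReal x v)) := by
  refine ⟨fun μ _ hne hlt hsurj => ?_, fun r hr s t hs hst => ?_, fun a γ _ hγ s t hs hst => ?_,
    fun κ ρ hκ hρ s t hs hst => poissonBase_mem_Omega hκ hρ hs hst,
    fun x v hv s t _ hst => gaussianReal_mem_Omega hv hst⟩
  · have h : IsSteep μ := ⟨hne, hlt, hsurj⟩
    exact ⟨fun hmon hlog => ⟨suppSup_eq_top_of_monotoneOn hlt (nonempty_interior_Theta hne) hmon,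
      fun s t hs ht hst hA hB => h.mem_Omega hlog hs ht hst hA hB⟩,
      fun _ s t hs ht hst hB => h.notMem_Omega hs ht hst hB⟩
  · exact ⟨negBinBase_mem_Omega hr hs hst, negBinBase_blowUp hr hs hst⟩
  · exact ⟨gammaBase_mem_Omega hγ hs hst, gammaBase_blowUp hγ hs hst⟩
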